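/- **Setting.** Jack sends packets from time $0$ on; his inter-packet delays (the first one counted from time $0$) are i.i.d. with a density $p$ that is strictly positive exactly on $(0,\infty)$ and has finite mean $\lambda^{-1}=\int_0^\infty x\,p(x)\,dx$. Let $\tau(i)$ be the time of his $i$-th packet ($\tau(0)=0$). The packets pass first Alice, then Bob, then reach Steve. Alice may buffer Jack's packets, release them in their order, and insert packets of her own; Bob recognizes and removes Alice's packets and may buffer Jack's packets and release them in their order. Both act causally, each using an own private random seed (the seeds are independent of each other and of Jack's stream); neither stops relaying, and only finitely many packets are sent in a bounded time. The warden Willie sees the sequence of inter-packet delays either on the link Alice–Bob (location 1) or on the link Bob–Steve (location 2). A test is a measurable set $D$ of delay sequences. $P_{FA}$ is the probability that Jack's unchanged delay sequence lies in $D$, and $P_{MD}$ the probability that the sequence observed when Alice and Bob use their strategy does not lie in $D$. A strategy is $\epsilon$-covert if $P_{FA}+P_{MD}\ge 1-\epsilon$ for every test and in each of the two locations. $N_a$ is the number of packets that Alice inserts during $[0,\tau(N)]$, the time in which Jack sends $N$ packets, and $J$ is the number of Jack's packets that she releases in that time. **Regularity.** With $p^-(x,\rho)=(1-\rho)\,p((1-\rho)x)$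 assume: (c1) $\log p^-(x,\cdot)$ is three times differentiable at every $\rho\in(0,1)$, for every $x>0$; (c2) there are $\delta\in(0,1]$ and functions $F,G,H$ on $(0,\infty)$ with $\int F<\infty$, $\int G<\infty$, $\int pH<\infty$ such that $|\partial_\rho p^-|<F(x)$, $|\partial_\rho^2p^-|<G(x)$ and $|\partial_\rho^3\log p^-|<H(x)$ for all $x>0$ and $\rho\in(0,\delta)$; (c3) $\int_0^\infty\partial_\rho p^-(x,0)\,dx=\int_0^\infty\partial_\rho^2p^-(x,0)\,dx=0$. **Theorem.** (*Achievability*) For every $\epsilon>0$ and $\psi\in(0,1)$ there are constants $0<d\le d'$ and, for every $N$, a strategy and a $\rho_N\in(0,1)$ such that the strategy is $\epsilon$-covert for all sufficiently large $N$, $\Pr(d\sqrt N\le N_a\le d'\sqrt N)\to1$ as $N\to\infty$, and the strategy is two-phase with $k=\lfloor\psi N\rfloor$ and $\rho=\rho_N$ in the following sense. Alice never changes the packet times. In the first phase, which ends at time $\tau(k)/(1-\rho)$, Alice is idle and Bob sends the $i$-th packet at time $\tau(i)/(1-\rho)$, $i\le k$. After it Alice replaces some finite number $j$ of Jack's packets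 by her own, and Bob sends the packet $k+i$, $i\ge1$, at time $\tau(k+j+i)+\varphi$ with a constant delay $\varphi\ge0$ ($j$ and $\varphi$ may depend on the realization). (*Converse*) Suppose moreover that $\int_0^\infty x^2p(x)\,dx<\infty$, and let $f:\mathbb N\to\mathbb N$ with $f(N)/\sqrt N\to\infty$. Then there are, for every $N$, two threshold tests on the mean of a fixed number of initial inter-packet delays, which depend only on $p$, $f$ and $N$: test 1, for use in location 1, decides "insertion" if the mean is at most $\lambda^{-1}-U_1(N)$, and test 2, for use in location 2, decides "insertion" if the mean is at least $\lambda^{-1}+U_2(N)$. Their false alarm probabilities tend to $0$ as $N\to\infty$, and for all strategies (one for each $N$) with $\Pr(N_a\ge f(N))\to1$: (i) if Alice inserts her packets without holding back Jack's, i.e. $\Pr(J=N)\to1$, then $P_{FA}+P_{MD}\to0$ for test 1; (ii) if Alice only replaces packets, i.e. $\Pr(J+N_a\le N)\to1$, then $P_{FA}+P_{MD}\to0$ for test 2; (iii) without either assumption, the probability that neither test 1 in location 1 nor test 2 in location 2 decides "insertion" tends to $0$. -/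

import Mathlib

open MeasureTheory Set Filter Topology
open scoped unitInterval

namespace CovertInsertion

/-! ### Jack's renewal stream -/

/-- A probability density `p` of inter-packet delays with support `ℝ⁺` (strictly positive on
`(0, ∞)`) and finite mean, so that the rate `λ = (∫ x p(x) dx)⁻¹` makes sense. Only the values of
`p` on `(0, ∞)` are used. -/
structure IPDDensity where
  /-- the density -/
  pdf : ℝ → ℝ
  pdf_pos : ∀ x, 0 < x → 0 < pdf x
  integral_pdf : ∫ x in Ioi (0 : ℝ), pdf x = 1
  integrable_mean : IntegrableOn (fun x => x * pdf x) (Ioi 0)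

namespace IPDDensity

/-- The law on `ℝ` with density `p` on `(0, ∞)`. -/
noncomputable def law (p : IPDDensity) : Measure ℝ :=
  (volume.restrict (Ioi (0 : ℝ))).withDensity (fun x => ENNReal.ofReal (p.pdf x))

instance (p : IPDDensity) : IsProbabilityMeasure p.law := by
  have hint : Integrable p.pdf (volume.restrict (Ioi (0 : ℝ))) := by
    by_contra h
    have h1 := p.integral_pdf
    rw [integral_undef h] at h1
    exact zero_ne_one h1
  have hnn : 0 ≤ᵐ[volume.restrict (Ioi (0 : ℝ))] p.pdf :=
    (ae_restrict_iff' measurableSet_Ioi).2 (ae_of_all _ fun x hx => (p.pdf_pos x hx).le)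
  constructor
  rw [law, withDensity_apply _ MeasurableSet.univ, Measure.restrict_univ,
    ← ofReal_integral_eq_lintegral_ofReal hint hnn, p.integral_pdf, ENNReal.ofReal_one]

/-- The mean inter-packet delay `λ⁻¹ = ∫ x p(x) dx`. -/
noncomputable def mean (p : IPDDensity) : ℝ := ∫ x in Ioi (0 : ℝ), x * p.pdf x

/-- The law of Jack's sequence of inter-packet delays: i.i.d. with density `p`. -/
noncomputable def streamLaw (p : IPDDensity) : Measure (ℕ → ℝ) :=
  Measure.infinitePi (fun _ : ℕ => p.law)

/-- The stretched density `p⁻(x, ρ) = (1 - ρ) p((1 - ρ) x)`. -/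
noncomputable def pMinus (p : IPDDensity) (x ρ : ℝ) : ℝ := (1 - ρ) * p.pdf ((1 - ρ) * x)

/-- The regularity conditions on `p⁻`: three derivatives of `log p⁻` in `ρ`; domination, near
`ρ = 0`, of the first two derivatives of `p⁻` and of the third derivative of `log p⁻`; vanishing of
the integrals of the first two derivatives of `p⁻` at `ρ = 0`. -/
structure Regular (p : IPDDensity) : Prop where
  exists_derivs : ∀ x, 0 < x → ∀ ρ ∈ Ioo (0 : ℝ) 1, ∀ k : ℕ, k < 3 →
    DifferentiableAt ℝ (iteratedDeriv k (fun r => Real.log (p.pMinus x r))) ρ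
  dominated : ∃ δ ∈ Ioc (0 : ℝ) 1, ∃ F G H : ℝ → ℝ,
    IntegrableOn F (Ioi 0) ∧ IntegrableOn G (Ioi 0) ∧
    IntegrableOn (fun x => p.pdf x * H x) (Ioi 0) ∧
    ∀ x, 0 < x → ∀ ρ ∈ Ioo (0 : ℝ) δ,
      |deriv (fun r => p.pMinus x r) ρ| < F x ∧
      |iteratedDeriv 2 (fun r => p.pMinus x r) ρ| < G x ∧
      |iteratedDeriv 3 (fun r => Real.log (p.pMinus x r)) ρ| < H x
  integral_deriv : ∫ x in Ioi (0 : ℝ), deriv (fun r => p.pMinus x r) 0 = 0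
  integral_deriv_two : ∫ x in Ioi (0 : ℝ), iteratedDeriv 2 (fun r => p.pMinus x r) 0 = 0

end IPDDensity

/-! ### Packet streams

A stream is the sequence of the times of its packets, numbered from `0`; time starts at `0`. -/

/-- Packet times from inter-packet delays. -/
def arrivals (z : ℕ → ℝ) (n : ℕ) : ℝ := ∑ i ∈ Finset.range (n + 1), z i

/-- Inter-packet delays from packet times (the first one is counted from time `0`). -/
def delays (t : ℕ → ℝ) : ℕ → ℝ
  | 0 => t 0
  | n + 1 => t (n + 1) - t n

/-- The time at which the first `N` packets of the stream `x` have been sent. -/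
def timeOf (x : ℕ → ℝ) : ℕ → ℝ
  | 0 => 0
  | n + 1 => x n

/-- Possible streams of Jack (almost every stream is of this kind). -/
def IsStream (x : ℕ → ℝ) : Prop := StrictMono x ∧ 0 < x 0 ∧ Tendsto x atTop atTop

/-- A stream of packets labelled `true` if the packet is one of Alice's, `false` if it is one of
Jack's. -/
abbrev LabelledStream : Type := ℕ → ℝ × Bool

/-- `x` and `x'` show the same packets up to and including time `t`. -/
def AgreeUpTo (t : ℝ) (x x' : ℕ → ℝ) : Prop := ∀ n, x n ≤ t ∨ x' n ≤ t → x n = x' n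

/-- `y` and `y'` show the same labelled packets up to and including time `t`. -/
def LabelledAgreeUpTo (t : ℝ) (y y' : LabelledStream) : Prop :=
  ∀ n, (y n).1 ≤ t ∨ (y' n).1 ≤ t → y n = y' n

/-- The number of Jack's packets among the first `n` packets of `y`. -/
def jackAmong (y : LabelledStream) (n : ℕ) : ℕ := Nat.count (fun i => (y i).2 = false) n

/-- The number of Alice's packets in `y` up to and including time `t`. -/
noncomputable def covertBy (y : LabelledStream) (t : ℝ) : ℕ :=
  Set.ncard {n | (y n).2 = true ∧ (y n).1 ≤ t}

/-- The number of Jack's packets in `y` up to and including time `t`. -/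
noncomputable def jackBy (y : LabelledStream) (t : ℝ) : ℕ :=
  Set.ncard {n | (y n).2 = false ∧ (y n).1 ≤ t}

/-! ### Strategies of Alice and Bob -/

/-- A joint strategy of Alice and Bob. Each of them has a private random seed, uniform on `[0, 1]`.
Alice sees Jack's packet times and produces the labelled stream on the link from Alice to Bob:
she may hold Jack's packets back in a buffer, release them in their order, and insert packets of
her own. Bob sees that labelled stream, takes Alice's packets out, and produces the stream on the
link from Bob to Steve, which consists of all of Jack's packets in their order, each possibly
delayed in his buffer. -/
structure Strategy where
  /-- the packets that leave Alice, as a function of her seed and of Jack's packet times -/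
  alice : I → (ℕ → ℝ) → LabelledStream
  /-- the times of the packets that leave Bob, as a function of his seed and of his input -/
  bob : I → LabelledStream → ℕ → ℝ
  measurable_alice : Measurable (Function.uncurry alice)
  measurable_bob : Measurable (Function.uncurry bob)
  alice_nonneg : ∀ v x, IsStream x → ∀ n, 0 ≤ (alice v x n).1
  alice_mono : ∀ v x, IsStream x → Monotone (fun n => (alice v x n).1)
  alice_tendsto : ∀ v x, IsStream x → Tendsto (fun n => (alice v x n).1) atTop atTop
  bob_mono : ∀ v w x, IsStream x → Monotone (bob w (alice v x))
  /-- What Alice does up to time `t` depends only on her seed and on what she saw up to `t`. -/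
  alice_causal : ∀ v x x' t, IsStream x → IsStream x' → AgreeUpTo t x x' →
    LabelledAgreeUpTo t (alice v x) (alice v x')
  /-- What Bob does up to time `t` depends only on his seed and on what he saw up to `t`. -/
  bob_causal : ∀ w v v' x x' t, IsStream x → IsStream x' →
    LabelledAgreeUpTo t (alice v x) (alice v' x') →
    AgreeUpTo t (bob w (alice v x)) (bob w (alice v' x'))
  /-- Alice sends a packet of Jack only when it has arrived: if her packet `n` is one of Jack's, it
  is his packet number `jackAmong _ n`. -/
  alice_feasible : ∀ v x, IsStream x → ∀ n, (alice v x n).2 = false →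
    x (jackAmong (alice v x) n) ≤ (alice v x n).1
  /-- Bob's packet `n` is Jack's packet number `n`, sent when it has reached Bob. -/
  bob_feasible : ∀ v w x, IsStream x → ∀ n, ∃ k, (alice v x k).2 = false ∧
    jackAmong (alice v x) k = n ∧ (alice v x k).1 ≤ bob w (alice v x) n

/-- The sample space: Jack's inter-packet delays, Alice's seed, Bob's seed. -/
abbrev Sample : Type := (ℕ → ℝ) × I × I

/-- Jack's delays are i.i.d. with density `p`; the seeds are uniform; all are independent. -/
noncomputable def sampleLaw (p : IPDDensity) : Measure Sample :=
  p.streamLaw.prod ((volume : Measure I).prod (volume : Measure I))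

namespace Strategy

/-- The labelled stream that leaves Alice. -/
def aliceOut (S : Strategy) (ω : Sample) : LabelledStream := S.alice ω.2.1 (arrivals ω.1)

/-- Willie between Alice and Bob (setting 1): the inter-packet delays that he observes. -/
def obs₁ (S : Strategy) (ω : Sample) : ℕ → ℝ := delays (fun n => (S.aliceOut ω n).1)

/-- Willie between Bob and Steve (setting 2): the inter-packet delays that he observes. -/
def obs₂ (S : Strategy) (ω : Sample) : ℕ → ℝ := delays (S.bob ω.2.2 (S.aliceOut ω))

/-- The number `N_a` of packets inserted by Alice while Jack sends his first `N` packets. -/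
noncomputable def inserted (S : Strategy) (N : ℕ) (ω : Sample) : ℕ :=
  covertBy (S.aliceOut ω) (timeOf (arrivals ω.1) N)

/-- The number of Jack's packets that Alice has released when he sends his `N`-th packet. -/
noncomputable def released (S : Strategy) (N : ℕ) (ω : Sample) : ℕ :=
  jackBy (S.aliceOut ω) (timeOf (arrivals ω.1) N)

/-- The two-phase schemes. In the first phase, which ends when Bob sends the `k`-th packet, Alice is
idle and Bob stretches the stream by the factor `1 / (1 - ρ)`. In the second phase Alice replaces
`j` of Jack's packets by her own, without any change of the timing, and Bob delays the stream by a
constant `φ` and fills the `j` places with packets from his buffer. -/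
structure IsTwoPhase (S : Strategy) (k : ℕ) (ρ : ℝ) : Prop where
  alice_timing : ∀ v x, IsStream x → ∀ n, (S.alice v x n).1 = x n
  alice_idle : ∀ v x, IsStream x → ∀ n, (S.alice v x n).2 = true → timeOf x k / (1 - ρ) < x n
  bob_first : ∀ v w x, IsStream x → ∀ n, n < k → S.bob w (S.alice v x) n = x n / (1 - ρ)
  second : ∀ v w x, IsStream x → ∃ (j : ℕ) (φ : ℝ), 0 ≤ φ ∧
    {n | (S.alice v x n).2 = true}.encard = j ∧
    ∀ i, S.bob w (S.alice v x) (k + i) = x (k + j + i) + φ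

end Strategy

/-! ### Willie's tests

A test is a set `D` of sequences of inter-packet delays: Willie decides `H₁` if he observes a
sequence in `D`, and `H₀` otherwise. -/

/-- `P_FA + P_MD` of the test `D` when Willie observes `obs`, a function of the sample, under
`H₁`, and Jack's unchanged stream under `H₀`. -/
noncomputable def errorSum (p : IPDDensity) (obs : Sample → ℕ → ℝ) (D : Set (ℕ → ℝ)) : ℝ :=
  p.streamLaw.real D + (sampleLaw p).real {ω | obs ω ∉ D}

/-- Every test has `P_FA + P_MD ≥ 1 - ε`, in each of the two possible locations of Willie. -/
def IsCovert (p : IPDDensity) (S : Strategy) (ε : ℝ) : Prop :=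
  ∀ D : Set (ℕ → ℝ), MeasurableSet D →
    1 - ε ≤ errorSum p S.obs₁ D ∧ 1 - ε ≤ errorSum p S.obs₂ D

/-- The mean of the first `R` inter-packet delays. -/
noncomputable def meanDelay (R : ℕ) (z : ℕ → ℝ) : ℝ := (∑ i ∈ Finset.range R, z i) / R

/-- The threshold test that decides `H₁` if the mean delay is below `λ⁻¹` by `U` or more. -/
def shortDelayTest (p : IPDDensity) (R : ℕ) (U : ℝ) : Set (ℕ → ℝ) :=
  {z | meanDelay R z ≤ p.mean - U}

/-- The threshold test that decides `H₁` if the mean delay is above `λ⁻¹` by `U` or more. -/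
def longDelayTest (p : IPDDensity) (R : ℕ) (U : ℝ) : Set (ℕ → ℝ) :=
  {z | p.mean + U ≤ meanDelay R z}

end CovertInsertion

/-! Achievability. Alice leaves the timing alone, so location 1 reveals nothing. While Bob stretches
the first `k` delays by `1 / (1 - ρ)`, about `ρ k` packets pile up in his buffer; these later fill
the places of the packets that Alice replaces. With `ρ` of order `1 / √N` the buffer gains order
`√N` packets. At location 2 the stretched delays are i.i.d. with density `p⁻(·, ρ)` and the rest are
original delays of Jack. Hellinger affinity is multiplicative over products, so it suffices that one
stretched delay has affinity at least `1 - C ρ²` with `p`: for `k ≤ N` and `ρ = a / √(N + 1)` the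
product affinity is at least `1 - C a²`, and `a` is free. The quadratic bound
(`Regular.hellinger_le`) rests on the fact that the square root of a positive function with bounded
second derivative is Lipschitz (`abs_deriv_le_of_pos`). The number of replaced packets depends on
whether the buffer is full, which is an event about the same delays. Conditioning is avoided by a
coupling: on that event the observation equals `stretchDrop`, a transformation with a fixed number
of dropped delays whose law is an exact product. The complement costs only its probability, which
vanishes by the law of large numbers.

Converse. Let `g` be of larger order than `√N` with `2 g ≤ N_a` and `2 g ≤ N`. By time `τ(N)` Alice
has sent `J + N_a` packets. Either this is at least `N + g`, and then the first `N + g` delays at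
location 1 are too short on average; or `J < N - g`, and then Bob, who has only Jack's released
packets to send, is late with packet number `N - g`, and the delays at location 2 are too long. By
Chebyshev, `τ(n)` for `n ≤ 2 N` fluctuates by order `√N`, so a shift of order `g` is detected with
vanishing error. -/

namespace CovertInsertion

open ProbabilityTheory

/-! ### Laws of a single delay and of Jack's stream -/

namespace IPDDensity

variable (p : IPDDensity)

lemma integrableOn_pdf : IntegrableOn p.pdf (Ioi 0) := by
  by_contra h
  have h1 := p.integral_pdf
  rw [integral_undef h] at h1
  exact zero_ne_one h1

lemma aemeasurable_ofReal_pdf :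
    AEMeasurable (fun x => ENNReal.ofReal (p.pdf x)) (volume.restrict (Ioi (0 : ℝ))) :=
  p.integrableOn_pdf.aestronglyMeasurable.aemeasurable.ennreal_ofReal

lemma integral_law (g : ℝ → ℝ) : ∫ x, g x ∂p.law = ∫ x in Ioi (0 : ℝ), p.pdf x * g x := by
  rw [law, integral_withDensity_eq_integral_toReal_smul₀ p.aemeasurable_ofReal_pdf
    (ae_of_all _ fun x => ENNReal.ofReal_lt_top)]
  refine setIntegral_congr_fun measurableSet_Ioi fun x hx => ?_
  simp [ENNReal.toReal_ofReal (p.pdf_pos x hx).le]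

lemma integrable_law_iff (g : ℝ → ℝ) :
    Integrable g p.law ↔ IntegrableOn (fun x => p.pdf x * g x) (Ioi 0) := by
  rw [law, integrable_withDensity_iff_integrable_smul₀' p.aemeasurable_ofReal_pdf
    (ae_of_all _ fun x => ENNReal.ofReal_lt_top)]
  refine integrableOn_congr_fun (fun x hx => ?_) measurableSet_Ioi
  simp [ENNReal.toReal_ofReal (p.pdf_pos x hx).le]

lemma ae_law_pos : ∀ᵐ x ∂p.law, 0 < x :=
  (withDensity_absolutelyContinuous _ _).ae_le (ae_restrict_mem measurableSet_Ioi)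

lemma integrable_id_law : Integrable (fun x => x) p.law := by
  rw [integrable_law_iff]
  simpa [mul_comm] using p.integrable_mean

lemma integral_id_law : ∫ x, x ∂p.law = p.mean := by
  rw [integral_law, mean]
  simp [mul_comm]

lemma mean_pos : 0 < p.mean := by
  rw [← integral_id_law, integral_pos_iff_support_of_nonneg_ae
    (p.ae_law_pos.mono fun x hx => hx.le) p.integrable_id_law]
  have h : p.law (Function.support fun x : ℝ => x) = 1 :=
    (prob_compl_eq_zero_iff (measurableSet_support measurable_id)).1
      (p.ae_law_pos.mono fun x hx => ne_of_gt hx)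
  rw [h]
  exact one_pos

instance : IsProbabilityMeasure p.streamLaw := by
  unfold streamLaw; infer_instance

lemma iIndepFun_eval : iIndepFun (fun (i : ℕ) (z : ℕ → ℝ) => z i) p.streamLaw :=
  iIndepFun_infinitePi (P := fun _ : ℕ => p.law) (X := fun _ x => x) fun _ => measurable_id

lemma measurePreserving_eval (i : ℕ) :
    MeasurePreserving (fun z : ℕ → ℝ => z i) p.streamLaw p.law :=
  measurePreserving_eval_infinitePi (fun _ : ℕ => p.law) i

lemma integrable_eval (i : ℕ) : Integrable (fun z : ℕ → ℝ => z i) p.streamLaw :=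
  (p.measurePreserving_eval i).integrable_comp_of_integrable p.integrable_id_law

lemma integral_eval (i : ℕ) : ∫ z, z i ∂p.streamLaw = p.mean := by
  rw [← integral_id_law, ← (p.measurePreserving_eval i).map_eq]
  exact (integral_map (p.measurePreserving_eval i).aemeasurable
    aestronglyMeasurable_id).symm

lemma ae_pos : ∀ᵐ z ∂p.streamLaw, ∀ i, 0 < z i :=
  ae_all_iff.2 fun i => (p.measurePreserving_eval i).quasiMeasurePreserving.ae p.ae_law_pos

lemma ae_tendsto_mean : ∀ᵐ z ∂p.streamLaw,
    Tendsto (fun n : ℕ => (∑ i ∈ Finset.range n, z i) / (n : ℝ)) atTop (𝓝 p.mean) := by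
  have h := strong_law_ae_real (μ := p.streamLaw) (fun (i : ℕ) (z : ℕ → ℝ) => z i)
    (p.integrable_eval 0) (fun i j hij => p.iIndepFun_eval.indepFun hij)
    (fun i => ⟨(measurable_pi_apply i).aemeasurable, (measurable_pi_apply 0).aemeasurable, by
      rw [(p.measurePreserving_eval i).map_eq, (p.measurePreserving_eval 0).map_eq]⟩)
  simpa only [integral_eval] using h

end IPDDensity

/-! ### Packet times, delays and measurability -/

lemma arrivals_zero (z : ℕ → ℝ) : arrivals z 0 = z 0 := by simp [arrivals]

lemma arrivals_succ (z : ℕ → ℝ) (n : ℕ) : arrivals z (n + 1) = arrivals z n + z (n + 1) := by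
  simp [arrivals, Finset.sum_range_succ _ (n + 1)]

lemma delays_arrivals (z : ℕ → ℝ) : delays (arrivals z) = z := by
  funext n
  cases n with
  | zero => simp [delays, arrivals_zero]
  | succ n => simp [delays, arrivals_succ]

lemma timeOf_arrivals (z : ℕ → ℝ) (n : ℕ) :
    timeOf (arrivals z) n = ∑ i ∈ Finset.range n, z i := by
  cases n <;> simp [timeOf, arrivals]

lemma sum_delays (t : ℕ → ℝ) (n : ℕ) : ∑ i ∈ Finset.range n, delays t i = timeOf t n := by
  induction n with
  | zero => simp [timeOf]
  | succ n ih =>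
    rw [Finset.sum_range_succ, ih]
    cases n <;> simp [timeOf, delays]

lemma measurable_arrivals : Measurable arrivals :=
  measurable_pi_lambda _ fun _ => Finset.measurable_sum _ fun i _ => measurable_pi_apply i

lemma measurable_timeOf (n : ℕ) : Measurable (fun x : ℕ → ℝ => timeOf x n) := by
  cases n with
  | zero => exact measurable_const
  | succ n => exact measurable_pi_apply n

lemma measurable_delays : Measurable delays := by
  refine measurable_pi_lambda _ fun n => ?_
  cases n with
  | zero => exact measurable_pi_apply 0
  | succ n => exact (measurable_pi_apply (n + 1)).sub (measurable_pi_apply n)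

lemma IsStream.timeOf_strictMono {x : ℕ → ℝ} (hx : IsStream x) : StrictMono (timeOf x) := by
  refine strictMono_nat_of_lt_succ fun n => ?_
  cases n with
  | zero => exact hx.2.1
  | succ n => exact hx.1 n.lt_succ_self

lemma IPDDensity.ae_isStream (p : IPDDensity) : ∀ᵐ z ∂p.streamLaw, IsStream (arrivals z) := by
  filter_upwards [p.ae_pos, p.ae_tendsto_mean] with z hz hl
  refine ⟨strictMono_nat_of_lt_succ fun n => ?_, ?_, ?_⟩
  · rw [arrivals_succ]; linarith [hz (n + 1)]
  · rw [arrivals_zero]; exact hz 0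
  · have h := hl.pos_mul_atTop p.mean_pos tendsto_natCast_atTop_atTop
    refine ((tendsto_add_atTop_iff_nat 1).2 h).congr fun n => ?_
    have : ((n + 1 : ℕ) : ℝ) ≠ 0 := by positivity
    rw [div_mul_cancel₀ _ this, arrivals]

instance (p : IPDDensity) : IsProbabilityMeasure (sampleLaw p) := by
  unfold sampleLaw; infer_instance

lemma measurePreserving_fst (p : IPDDensity) :
    MeasurePreserving (Prod.fst : Sample → ℕ → ℝ) (sampleLaw p) p.streamLaw :=
  MeasureTheory.measurePreserving_fst

lemma ae_sample_isStream (p : IPDDensity) : ∀ᵐ ω ∂sampleLaw p, IsStream (arrivals ω.1) :=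
  (measurePreserving_fst p).quasiMeasurePreserving.ae p.ae_isStream

/-- Counting measurably many measurable events is measurable. -/
lemma measurable_ncard {Ω : Type*} [MeasurableSpace Ω] {P : ℕ → Ω → Prop}
    (hP : ∀ n, MeasurableSet {ω | P n ω}) : Measurable (fun ω => Set.ncard {n | P n ω}) := by
  refine measurable_of_Ici fun a => ?_
  rcases Nat.eq_zero_or_pos a with rfl | ha
  · simp
  -- `Set.ncard` is `0` on infinite sets. For `a > 0`, having at least `a` elements therefore means
  -- being bounded and containing some `Finset` of cardinality `a`: countable operations on the
  -- given events.
  have : (fun ω => Set.ncard {n | P n ω}) ⁻¹' Ici a =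
      (⋃ m : ℕ, ⋂ n : ℕ, ⋂ _ : m ≤ n, {ω | P n ω}ᶜ) ∩
      ⋃ s : Finset ℕ, ⋃ _ : s.card = a, ⋂ n ∈ s, {ω | P n ω} := by
    ext ω
    simp only [mem_preimage, mem_Ici, mem_inter_iff, mem_iUnion, mem_iInter, mem_compl_iff,
      mem_ofPred_eq]
    constructor
    · intro h
      have hfin : {n | P n ω}.Finite := Set.finite_of_ncard_pos (ha.trans_le h)
      refine ⟨?_, ?_⟩
      · obtain ⟨m, hm⟩ := hfin.bddAbove
        exact ⟨m + 1, fun n hn hc => by have := hm hc; omega⟩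
      · obtain ⟨t, ht, hta⟩ := Set.exists_subset_card_eq h
        have htf := hfin.subset ht
        refine ⟨htf.toFinset, by rw [← Set.ncard_eq_toFinset_card _ htf, hta], fun n hn => ?_⟩
        exact ht (htf.mem_toFinset.1 hn)
    · rintro ⟨⟨m, hm⟩, s, rfl, hs⟩
      have hfin : {n | P n ω}.Finite := (Set.finite_lt_nat m).subset fun n hn => by
        by_contra hc
        exact hm n (not_lt.1 hc) hn
      rw [← Set.ncard_coe_finset]
      exact Set.ncard_le_ncard (fun n hn => hs n hn) hfin
  rw [this]
  refine (MeasurableSet.iUnion fun m => MeasurableSet.iInter fun n => MeasurableSet.iInter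
    fun _ => (hP n).compl).inter (MeasurableSet.iUnion fun s => MeasurableSet.iUnion fun _ =>
    Finset.measurableSet_biInter s fun n _ => hP n)

namespace Strategy

lemma measurable_aliceOut (S : Strategy) : Measurable S.aliceOut :=
  S.measurable_alice.comp ((measurable_fst.comp measurable_snd).prodMk
    (measurable_arrivals.comp measurable_fst))

lemma measurable_count (S : Strategy) (N : ℕ) (b : Bool) : Measurable (fun ω : Sample =>
    Set.ncard {n | (S.aliceOut ω n).2 = b ∧ (S.aliceOut ω n).1 ≤ timeOf (arrivals ω.1) N}) := by
  refine measurable_ncard fun n => ?_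
  have h : Measurable fun ω => S.aliceOut ω n := (measurable_pi_apply n).comp S.measurable_aliceOut
  exact (measurableSet_eq_fun h.snd measurable_const).inter
    (measurableSet_le h.fst ((measurable_timeOf N).comp (measurable_arrivals.comp measurable_fst)))

lemma measurable_inserted (S : Strategy) (N : ℕ) : Measurable (S.inserted N) :=
  S.measurable_count N true

lemma measurable_released (S : Strategy) (N : ℕ) : Measurable (S.released N) :=
  S.measurable_count N false

lemma measurable_obs₂ (S : Strategy) : Measurable S.obs₂ :=
  measurable_delays.comp (S.measurable_bob.comp
    ((measurable_snd.comp measurable_snd).prodMk S.measurable_aliceOut))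

end Strategy

/-! ### Packet counts and the threshold tests of the converse -/

lemma meanDelay_delays (t : ℕ → ℝ) (R : ℕ) : meanDelay R (delays t) = timeOf t R / R := by
  rw [meanDelay, sum_delays]

/-- If packet `r` came after `t`, monotonicity would confine all packets up to `t` to the indices
below `r`, hence to at most `r` packets. Turns an excess of packets into short delays at location 1.
-/
lemma le_of_count_ge {y : LabelledStream} (hy : Monotone fun n => (y n).1) {t : ℝ} {r : ℕ}
    (h : r < covertBy y t + jackBy y t) : (y r).1 ≤ t := by
  by_contra! hc
  have hlt : ∀ n, (y n).1 ≤ t → n < r := fun n hn => by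
    by_contra! hrn
    exact absurd (hy hrn) (not_le.2 (hn.trans_lt hc))
  have hfin := Set.finite_lt_nat r
  have h1 : {n | (y n).2 = true ∧ (y n).1 ≤ t} ⊆ {n | n < r} := fun n hn => hlt n hn.2
  have h2 : {n | (y n).2 = false ∧ (y n).1 ≤ t} ⊆ {n | n < r} := fun n hn => hlt n hn.2
  have hd : Disjoint {n | (y n).2 = true ∧ (y n).1 ≤ t} {n | (y n).2 = false ∧ (y n).1 ≤ t} :=
    Set.disjoint_left.2 fun n hn hn' => by simp_all
  have hu := Set.ncard_union_eq hd (hfin.subset h1) (hfin.subset h2)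
  have hle := Set.ncard_le_ncard (Set.union_subset h1 h2) hfin
  have hr : {n | n < r}.ncard = r := by
    have : {n | n < r} = ((Finset.range r : Finset ℕ) : Set ℕ) := by ext; simp
    rw [this, Set.ncard_coe_finset, Finset.card_range]
  rw [hu, hr] at hle
  exact absurd h (not_lt.2 hle)

/-- If packet `k` were sent by time `t`, it and the `jackAmong y k` packets of Jack before it would
all be counted by `jackBy y t`, one too many. -/
lemma lt_of_jackBy_le {y : LabelledStream} (hy : Monotone fun n => (y n).1)
    (hy' : Tendsto (fun n => (y n).1) atTop atTop) {t : ℝ} {k : ℕ} (hk : (y k).2 = false)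
    (h : jackBy y t ≤ jackAmong y k) : t < (y k).1 := by
  by_contra! hc
  -- Finiteness is essential here: on an infinite set `jackBy` would take the default value `0` and
  -- the hypothesis would be void.
  have hfin : {n | (y n).2 = false ∧ (y n).1 ≤ t}.Finite := by
    obtain ⟨m, hm⟩ := (hy'.eventually_gt_atTop t).exists_forall_of_atTop
    exact (Set.finite_lt_nat m).subset fun n hn => by
      by_contra hmn
      exact absurd hn.2 (not_le.2 (hm n (not_lt.1 hmn)))
  have hsub : ((Finset.range (k + 1)).filter (fun i => (y i).2 = false) : Set ℕ) ⊆
      {n | (y n).2 = false ∧ (y n).1 ≤ t} := fun n hn => by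
    simp only [Finset.coe_filter, Finset.mem_range, mem_ofPred_eq] at hn
    exact ⟨hn.2, (hy (Nat.lt_succ_iff.1 hn.1)).trans hc⟩
  have h1 := Set.ncard_le_ncard hsub hfin
  rw [Set.ncard_coe_finset, ← Nat.count_eq_card_filter_range, Nat.count_succ, if_pos hk] at h1
  exact absurd (h1.trans h) (by simp [jackAmong])

namespace Strategy

lemma lt_bob_of_released_le (S : Strategy) {ω : Sample} (hω : IsStream (arrivals ω.1)) {N n : ℕ}
    (h : S.released N ω ≤ n) : timeOf (arrivals ω.1) N < S.bob ω.2.2 (S.aliceOut ω) n := by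
  obtain ⟨k, hk, hkn, hle⟩ := S.bob_feasible ω.2.1 ω.2.2 _ hω n
  exact (lt_of_jackBy_le (S.alice_mono _ _ hω) (S.alice_tendsto _ _ hω) hk
    (h.trans hkn.ge)).trans_le hle

end Strategy

/-- Chebyshev's inequality for the time of Jack's `n`-th packet. -/
lemma IPDDensity.exists_chebyshev (p : IPDDensity)
    (h2 : IntegrableOn (fun x => x ^ 2 * p.pdf x) (Ioi 0)) :
    ∃ V : ℝ, 0 ≤ V ∧ ∀ (n : ℕ) (c : ℝ), 0 < c →
      p.streamLaw.real {z | c ≤ |timeOf (arrivals z) n - n * p.mean|} ≤ n * V / c ^ 2 := by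
  have hmem : MemLp (fun x : ℝ => x) 2 p.law := by
    refine (memLp_two_iff_integrable_sq aestronglyMeasurable_id).2 ?_
    rw [integrable_law_iff]
    simpa [mul_comm] using h2
  have hmem' : ∀ i, MemLp (fun z : ℕ → ℝ => z i) 2 p.streamLaw := fun i =>
    hmem.comp_measurePreserving (p.measurePreserving_eval i)
  refine ⟨Var[fun x => x; p.law], variance_nonneg _ _, fun n c hc => ?_⟩
  have hsum : (fun z : ℕ → ℝ => timeOf (arrivals z) n) =
      ∑ i ∈ Finset.range n, fun z : ℕ → ℝ => z i := by
    funext z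
    simp [timeOf_arrivals]
  have hV : ∀ i, Var[fun z : ℕ → ℝ => z i; p.streamLaw] = Var[fun x => x; p.law] := fun i => by
    rw [← (p.measurePreserving_eval i).map_eq]
    exact (variance_map aemeasurable_id (p.measurePreserving_eval i).aemeasurable).symm
  have hvar : Var[fun z : ℕ → ℝ => timeOf (arrivals z) n; p.streamLaw] =
      n * Var[fun x => x; p.law] := by
    rw [hsum, IndepFun.variance_sum (fun i _ => hmem' i)
      (fun i _ j _ hij => p.iIndepFun_eval.indepFun hij)]
    simp [hV]
  have hmean : ∫ z, timeOf (arrivals z) n ∂p.streamLaw = n * p.mean := by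
    simp only [timeOf_arrivals]
    rw [integral_finsetSum _ fun i _ => p.integrable_eval i]
    simp [integral_eval]
  have hm : MemLp (fun z : ℕ → ℝ => timeOf (arrivals z) n) 2 p.streamLaw := by
    rw [hsum]
    exact memLp_finsetSum' _ fun i _ => hmem' i
  have h := meas_ge_le_variance_div_sq hm hc
  rw [hvar, hmean] at h
  exact ENNReal.toReal_le_of_le_ofReal
    (div_nonneg (mul_nonneg n.cast_nonneg (variance_nonneg _ _)) (sq_nonneg c)) h

/-- A union bound in which `B` and `C` are the likely events. `A` and `D` need not be measurable,
which allows `A` to be a missed detection and `D` the exceptional event. -/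
lemma measureReal_le_of_ae {Ω : Type*} [MeasurableSpace Ω] {P : Measure Ω} [IsProbabilityMeasure P]
    {A D B C : Set Ω} (hB : MeasurableSet B) (hC : MeasurableSet C)
    (h : ∀ᵐ ω ∂P, ω ∈ A → ω ∈ B → ω ∈ C → ω ∈ D) :
    P.real A ≤ P.real D + (1 - P.real B) + (1 - P.real C) := by
  have h1 : P.real A ≤ P.real (D ∪ Bᶜ ∪ Cᶜ) := by
    refine ENNReal.toReal_mono (measure_ne_top _ _) (measure_mono_ae ?_)
    filter_upwards [h] with ω hω hA
    by_cases h1 : ω ∈ B <;> by_cases h2 : ω ∈ C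
    · exact Or.inl (Or.inl (hω hA h1 h2))
    · exact Or.inr h2
    · exact Or.inl (Or.inr h1)
    · exact Or.inr h2
  have h2 := measureReal_union_le (μ := P) (D ∪ Bᶜ) Cᶜ
  have h3 := measureReal_union_le (μ := P) D Bᶜ
  rw [probReal_compl_eq_one_sub hB] at h3
  rw [probReal_compl_eq_one_sub hC] at h2
  linarith

lemma tendsto_min_half {f : ℕ → ℕ}
    (hf : Tendsto (fun N : ℕ => (f N : ℝ) / √(N : ℝ)) atTop atTop) :
    Tendsto (fun N : ℕ => ((min (f N / 2) (N / 2) : ℕ) : ℝ) / √(N : ℝ)) atTop atTop := by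
  have hs : Tendsto (fun N : ℕ => √(N : ℝ)) atTop atTop :=
    Real.tendsto_sqrt_atTop.comp tendsto_natCast_atTop_atTop
  refine tendsto_atTop.2 fun b => ?_
  filter_upwards [tendsto_atTop.1 hf (2 * b + 2), tendsto_atTop.1 hs (2 * b + 2),
    tendsto_atTop.1 hs 1] with N h1 h2 h3
  have hp : 0 < √(N : ℝ) := by linarith
  have hsq : √(N : ℝ) * √(N : ℝ) = N := Real.mul_self_sqrt N.cast_nonneg
  rw [le_div_iff₀ hp] at h1 ⊢
  have e1 : (f N : ℝ) ≤ 2 * (f N / 2 : ℕ) + 1 := by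
    exact_mod_cast (by omega : f N ≤ 2 * (f N / 2) + 1)
  have e2 : (N : ℝ) ≤ 2 * (N / 2 : ℕ) + 1 := by
    exact_mod_cast (by omega : N ≤ 2 * (N / 2) + 1)
  rw [Nat.cast_min]
  refine le_min ?_ ?_
  · linarith
  · nlinarith

theorem converse (p : IPDDensity) (h2 : IntegrableOn (fun x => x ^ 2 * p.pdf x) (Ioi 0))
    (f : ℕ → ℕ) (hf : Tendsto (fun N : ℕ => (f N : ℝ) / √(N : ℝ)) atTop atTop) :
    ∃ (R₁ R₂ : ℕ → ℕ) (U₁ U₂ : ℕ → ℝ),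
      Tendsto (fun N => p.streamLaw.real (shortDelayTest p (R₁ N) (U₁ N))) atTop (𝓝 0) ∧
      Tendsto (fun N => p.streamLaw.real (longDelayTest p (R₂ N) (U₂ N))) atTop (𝓝 0) ∧
      ∀ S : ℕ → Strategy,
        Tendsto (fun N => (sampleLaw p).real {ω | f N ≤ (S N).inserted N ω}) atTop (𝓝 1) →
        (Tendsto (fun N => (sampleLaw p).real {ω | (S N).released N ω = N}) atTop (𝓝 1) →
          Tendsto (fun N => errorSum p (S N).obs₁ (shortDelayTest p (R₁ N) (U₁ N)))
            atTop (𝓝 0)) ∧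
        (Tendsto (fun N => (sampleLaw p).real
            {ω | (S N).released N ω + (S N).inserted N ω ≤ N}) atTop (𝓝 1) →
          Tendsto (fun N => errorSum p (S N).obs₂ (longDelayTest p (R₂ N) (U₂ N)))
            atTop (𝓝 0)) ∧
        Tendsto (fun N => (sampleLaw p).real
            {ω | (S N).obs₁ ω ∉ shortDelayTest p (R₁ N) (U₁ N) ∧
                 (S N).obs₂ ω ∉ longDelayTest p (R₂ N) (U₂ N)}) atTop (𝓝 0) := by
  obtain ⟨V, hV, hcheb⟩ := p.exists_chebyshev h2
  have hμ := p.mean_pos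
  set μ := p.mean with hμdef
  -- The size of the effect to be detected. Half of `f N` is left for each alternative of the
  -- dichotomy; the cap `N / 2` keeps both sample sizes `N ± g` of order `N`.
  set g : ℕ → ℕ := fun N => min (f N / 2) (N / 2) with hgdef
  have hg := tendsto_min_half hf
  have hgf : ∀ N, 2 * g N ≤ f N := fun N => by simp only [hgdef]; omega
  have hgN : ∀ N, 2 * g N ≤ N := fun N => by simp only [hgdef]; omega
  have hg2 : ∀ᶠ N in atTop, 2 ≤ g N := by
    filter_upwards [tendsto_atTop.1 hg 2, eventually_ge_atTop 1] with N h1 h3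
    have h4 : 1 ≤ √(N : ℝ) := Real.one_le_sqrt.2 (by exact_mod_cast h3)
    rw [le_div_iff₀ (by linarith)] at h1
    exact_mod_cast (by linarith : (2 : ℝ) ≤ g N)
  let Dev : ℕ → ℕ → Set (ℕ → ℝ) := fun N n =>
    {z | g N * μ / 4 ≤ |timeOf (arrivals z) n - n * μ|}
  have hdev : ∀ n : ℕ → ℕ, (∀ᶠ N in atTop, n N ≤ 2 * N) →
      Tendsto (fun N => p.streamLaw.real (Dev N (n N))) atTop (𝓝 0) := by
    intro n hn
    -- Chebyshev with `n ≤ 2 N` and threshold `g μ / 4` gives `2 N V · 16 / (g μ)²`, which is the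
    -- constant `32 V / μ²` times `(g / √N)⁻²`.
    have hlim : Tendsto (fun N : ℕ => 32 * V / μ ^ 2 * (((g N : ℝ) / √(N : ℝ)) ^ 2)⁻¹) atTop
        (𝓝 0) := by
      have := (((tendsto_pow_atTop two_ne_zero).comp hg).inv_tendsto_atTop).const_mul
        (32 * V / μ ^ 2)
      rw [mul_zero] at this
      exact this
    refine squeeze_zero' (Eventually.of_forall fun N => measureReal_nonneg) ?_ hlim
    filter_upwards [hn, hg2] with N h1 h3
    have hg0 : (0 : ℝ) < g N := by exact_mod_cast (by omega : 0 < g N)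
    have hN0 : (0 : ℝ) < N := by exact_mod_cast (by have := hgN N; omega : 0 < N)
    refine (hcheb (n N) (g N * μ / 4) (by positivity)).trans ?_
    rw [div_pow (g N : ℝ), Real.sq_sqrt hN0.le]
    have h1' : (n N : ℝ) ≤ 2 * N := by exact_mod_cast h1
    calc (n N : ℝ) * V / (g N * μ / 4) ^ 2 ≤ 2 * N * V / (g N * μ / 4) ^ 2 := by gcongr
      _ = _ := by field_simp; ring
  have hadd : ∀ {a b : ℕ → ℝ}, Tendsto a atTop (𝓝 0) → Tendsto b atTop (𝓝 0) →
      Tendsto (fun N => a N + b N) atTop (𝓝 0) := fun ha hb => by simpa using ha.add hb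
  have hcompl : ∀ {a : ℕ → ℝ}, Tendsto a atTop (𝓝 1) →
      Tendsto (fun N => 1 - a N) atTop (𝓝 0) := fun ha => by simpa using ha.const_sub 1
  have hdevN := hdev (fun N => N) (Eventually.of_forall fun N => by omega)
  have hdevN' : Tendsto (fun N => (sampleLaw p).real (Prod.fst ⁻¹' Dev N N)) atTop (𝓝 0) := by
    refine hdevN.congr fun N => ?_
    rw [(measurePreserving_fst p).measureReal_preimage]
    exact (measurableSet_le measurable_const (((measurable_timeOf N).comp
      measurable_arrivals).sub measurable_const).abs).nullMeasurableSet
  -- In terms of times, test 1 alarms when packet number `N + g` (counted from one) comes by `(N +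
  -- g) μ - g μ / 2 = N μ + g μ / 2`. This lies between the typical `τ(N)` and the typical `τ(N +
  -- g)`, at distance `g μ / 2` from each.
  have hfa₁ : Tendsto (fun N => p.streamLaw.real
      (shortDelayTest p (N + g N) (g N * μ / 2 / (N + g N : ℕ)))) atTop (𝓝 0) := by
    refine squeeze_zero' (Eventually.of_forall fun N => measureReal_nonneg) ?_
      (hdev (fun N => N + g N) (Eventually.of_forall fun N => by have := hgN N; omega))
    filter_upwards [hg2] with N h3
    refine measureReal_mono fun z hz => ?_
    have hR : (0 : ℝ) < (N + g N : ℕ) := by exact_mod_cast (by omega : 0 < N + g N)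
    have hg0 : (0 : ℝ) < g N := by exact_mod_cast (by omega : 0 < g N)
    have hz' : meanDelay (N + g N) (delays (arrivals z)) ≤ p.mean - g N * μ / 2 / (N + g N : ℕ) := by
      rw [delays_arrivals]; exact hz
    rw [meanDelay_delays, div_le_iff₀ hR, sub_mul, div_mul_cancel₀ _ hR.ne'] at hz'
    change g N * μ / 4 ≤ |timeOf (arrivals z) (N + g N) - (N + g N : ℕ) * μ|
    rw [le_abs]
    right
    have : 0 < g N * μ := by positivity
    linarith
  -- The sample size `N - g + 1` ends at the packet with index `N - g`, the first one that Bob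
  -- cannot have sent if only `N - g` packets of Jack were released.
  have hfa₂ : Tendsto (fun N => p.streamLaw.real
      (longDelayTest p (N - g N + 1) (g N * μ / 4 / (N - g N + 1 : ℕ)))) atTop (𝓝 0) := by
    refine squeeze_zero' (Eventually.of_forall fun N => measureReal_nonneg) ?_
      (hdev (fun N => N - g N + 1) (by filter_upwards [eventually_ge_atTop 1] with N h; omega))
    filter_upwards [hg2] with N h3
    refine measureReal_mono fun z hz => ?_
    have hR : (0 : ℝ) < (N - g N + 1 : ℕ) := by exact_mod_cast (by omega : 0 < N - g N + 1)
    have hz' : p.mean + g N * μ / 4 / (N - g N + 1 : ℕ) ≤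
        meanDelay (N - g N + 1) (delays (arrivals z)) := by
      rw [delays_arrivals]; exact hz
    rw [meanDelay_delays, le_div_iff₀ hR, add_mul, div_mul_cancel₀ _ hR.ne'] at hz'
    change g N * μ / 4 ≤ |timeOf (arrivals z) (N - g N + 1) - (N - g N + 1 : ℕ) * μ|
    rw [le_abs]
    left
    linarith
  have hdet₁ : ∀ (S : Strategy) (N : ℕ) (ω : Sample), 2 ≤ g N → IsStream (arrivals ω.1) →
      ω.1 ∉ Dev N N → N + g N ≤ S.inserted N ω + S.released N ω →
      S.obs₁ ω ∈ shortDelayTest p (N + g N) (g N * μ / 2 / (N + g N : ℕ)) := by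
    intro S N ω h3 hω hD hc
    have hR : (0 : ℝ) < (N + g N : ℕ) := by exact_mod_cast (by omega : 0 < N + g N)
    have hg0 : (0 : ℝ) < g N := by exact_mod_cast (by omega : 0 < g N)
    have hle : timeOf (fun n => (S.aliceOut ω n).1) (N + g N) ≤ timeOf (arrivals ω.1) N := by
      obtain ⟨r, hr⟩ : ∃ r, N + g N = r + 1 := ⟨N + g N - 1, by omega⟩
      rw [hr]
      exact le_of_count_ge (S.alice_mono _ _ hω) (by
        change r < S.inserted N ω + S.released N ω
        omega)
    have hD' : |timeOf (arrivals ω.1) N - N * μ| < g N * μ / 4 := not_le.1 hD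
    have := (abs_lt.1 hD').2
    change meanDelay _ (delays _) ≤ p.mean - _
    rw [meanDelay_delays, div_le_iff₀ hR, sub_mul, div_mul_cancel₀ _ hR.ne']
    push_cast
    have : 0 < g N * μ := by positivity
    linarith
  -- The comparison is `N μ - g μ / 4 ≥ (N - g + 1) μ + g μ / 4`, which is exactly `g ≥ 2`: this
  -- absorbs the extra delay in the sample.
  have hdet₂ : ∀ (S : Strategy) (N : ℕ) (ω : Sample), 2 ≤ g N → IsStream (arrivals ω.1) →
      ω.1 ∉ Dev N N → S.released N ω ≤ N - g N →
      S.obs₂ ω ∈ longDelayTest p (N - g N + 1) (g N * μ / 4 / (N - g N + 1 : ℕ)) := by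
    intro S N ω h3 hω hD hc
    have hR : (0 : ℝ) < (N - g N + 1 : ℕ) := by exact_mod_cast (by omega : 0 < N - g N + 1)
    have hg0 : (2 : ℝ) ≤ g N := by exact_mod_cast h3
    have hlt := S.lt_bob_of_released_le hω hc
    have hD' : |timeOf (arrivals ω.1) N - N * μ| < g N * μ / 4 := not_le.1 hD
    have := (abs_lt.1 hD').1
    change p.mean + _ ≤ meanDelay _ (delays _)
    rw [meanDelay_delays, le_div_iff₀ hR, add_mul, div_mul_cancel₀ _ hR.ne']
    change _ ≤ S.bob ω.2.2 (S.aliceOut ω) (N - g N)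
    have hc : ((N - g N + 1 : ℕ) : ℝ) = N - g N + 1 := by
      rw [Nat.cast_add, Nat.cast_sub (by have := hgN N; omega), Nat.cast_one]
    rw [hc]
    nlinarith
  refine ⟨_, _, _, _, hfa₁, hfa₂, fun S hS => ⟨fun hJ => hadd hfa₁ ?_, fun hJ => hadd hfa₂ ?_, ?_⟩⟩
  · refine squeeze_zero' (Eventually.of_forall fun N => measureReal_nonneg) ?_
      (hadd (hadd hdevN' (hcompl hS)) (hcompl hJ))
    filter_upwards [hg2] with N h3
    refine measureReal_le_of_ae (measurableSet_le measurable_const ((S N).measurable_inserted N))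
      (measurableSet_eq_fun ((S N).measurable_released N) measurable_const) ?_
    filter_upwards [ae_sample_isStream p] with ω hω hA hB hC
    by_contra hD
    refine hA (hdet₁ (S N) N ω h3 hω hD ?_)
    have := hgf N
    have hB' : f N ≤ (S N).inserted N ω := hB
    have hC' : (S N).released N ω = N := hC
    omega
  · refine squeeze_zero' (Eventually.of_forall fun N => measureReal_nonneg) ?_
      (hadd (hadd hdevN' (hcompl hS)) (hcompl hJ))
    filter_upwards [hg2] with N h3
    refine measureReal_le_of_ae (measurableSet_le measurable_const ((S N).measurable_inserted N))
      (measurableSet_le (((S N).measurable_released N).add ((S N).measurable_inserted N))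
        measurable_const) ?_
    filter_upwards [ae_sample_isStream p] with ω hω hA hB hC
    by_contra hD
    refine hA (hdet₂ (S N) N ω h3 hω hD ?_)
    have := hgf N
    have hB' : f N ≤ (S N).inserted N ω := hB
    have hC' : (S N).released N ω + (S N).inserted N ω ≤ N := hC
    omega
  · refine squeeze_zero' (Eventually.of_forall fun N => measureReal_nonneg) ?_
      (hadd hdevN' (hcompl hS))
    filter_upwards [hg2] with N h3
    refine (measureReal_le_of_ae (D := Prod.fst ⁻¹' Dev N N)
      (B := {ω | f N ≤ (S N).inserted N ω}) (measurableSet_le measurable_const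
      ((S N).measurable_inserted N)) MeasurableSet.univ ?_).trans_eq (by simp)
    filter_upwards [ae_sample_isStream p] with ω hω hA hB _
    by_contra hD
    have := hgf N
    have := hgN N
    have hB' : f N ≤ (S N).inserted N ω := hB
    -- The dichotomy. If the count stays below `N + g` although `N_a ≥ 2 g`, then fewer than `N - g`
    -- of Jack's packets have been released.
    by_cases hc : N + g N ≤ (S N).inserted N ω + (S N).released N ω
    · exact hA.1 (hdet₁ (S N) N ω h3 hω hD hc)
    · exact hA.2 (hdet₂ (S N) N ω h3 hω hD (by omega))

/-! ### Hellinger affinity and products -/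

/-- A change of measure with density `G ^ 2` and affinity `∫ G` close to `1` changes the
probabilities only a little. -/
lemma withDensity_sq_le {Ω : Type*} [MeasurableSpace Ω] {μ : Measure Ω} [IsProbabilityMeasure μ]
    {G : Ω → ℝ} (hG : Measurable G)
    [IsProbabilityMeasure (μ.withDensity fun ω => ENNReal.ofReal (G ω ^ 2))]
    {D : Set Ω} (hD : MeasurableSet D) {t : ℝ} (ht : 0 < t) :
    (μ.withDensity fun ω => ENNReal.ofReal (G ω ^ 2)).real D ≤
      μ.real D + ((1 - ∫ ω, G ω ∂μ) / t + 2 * t) := by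
  have hl : ∫⁻ ω, ENNReal.ofReal (G ω ^ 2) ∂μ = 1 := by
    have := measure_univ (μ := μ.withDensity fun ω => ENNReal.ofReal (G ω ^ 2))
    rwa [withDensity_apply _ MeasurableSet.univ, Measure.restrict_univ] at this
  have hi2 : Integrable (fun ω => G ω ^ 2) μ := by
    refine ⟨(hG.pow_const 2).aestronglyMeasurable, ?_⟩
    rw [hasFiniteIntegral_iff_ofReal (ae_of_all _ fun ω => sq_nonneg _), hl]
    exact ENNReal.one_lt_top
  have hi1 : Integrable G μ :=
    ((memLp_two_iff_integrable_sq hG.aestronglyMeasurable).2 hi2).integrable one_le_two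
  have h2 : ∫ ω, G ω ^ 2 ∂μ = 1 := by
    rw [integral_eq_lintegral_of_nonneg_ae (ae_of_all _ fun ω => sq_nonneg _)
      (hG.pow_const 2).aestronglyMeasurable, hl, ENNReal.toReal_one]
  have hν : (μ.withDensity fun ω => ENNReal.ofReal (G ω ^ 2)).real D = ∫ ω in D, G ω ^ 2 ∂μ := by
    rw [integral_eq_lintegral_of_nonneg_ae (ae_of_all _ fun ω => sq_nonneg _)
      (hG.pow_const 2).aestronglyMeasurable, measureReal_def, withDensity_apply _ hD]
  set A := ∫ ω, G ω ∂μ with hA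
  have hid' : Integrable (fun ω => G ω ^ 2 - 2 * G ω) μ := hi2.sub (hi1.const_mul 2)
  have his' : Integrable (fun ω => G ω ^ 2 + 2 * G ω) μ := hi2.add (hi1.const_mul 2)
  have hid : Integrable (fun ω => G ω ^ 2 - 2 * G ω + 1) μ := hid'.add (integrable_const 1)
  have his : Integrable (fun ω => G ω ^ 2 + 2 * G ω + 1) μ := his'.add (integrable_const 1)
  have hd : ∫ ω, (G ω ^ 2 - 2 * G ω + 1) ∂μ = 2 - 2 * A := by
    rw [integral_add hid' (integrable_const 1),
      integral_sub hi2 (hi1.const_mul 2), integral_const_mul, h2]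
    simp; ring
  have hs : ∫ ω, (G ω ^ 2 + 2 * G ω + 1) ∂μ = 2 + 2 * A := by
    rw [integral_add his' (integrable_const 1),
      integral_add hi2 (hi1.const_mul 2), integral_const_mul, h2]
    simp; ring
  have hA1 : A ≤ 1 := by
    have : 0 ≤ 2 - 2 * A := hd ▸ integral_nonneg fun ω => by
      change 0 ≤ G ω ^ 2 - 2 * G ω + 1
      nlinarith [sq_nonneg (G ω - 1)]
    linarith
  -- The weighted mean inequality `(G - 1)(G + 1) ≤ (G - 1)² / (2 t) + t (G + 1)² / 2`, used
  -- pointwise in place of Cauchy–Schwarz. The two squares integrate to `2 - 2 A` and `2 + 2 A`.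
  let B : Ω → ℝ := fun ω => (2 * t)⁻¹ * (G ω ^ 2 - 2 * G ω + 1) +
    t / 2 * (G ω ^ 2 + 2 * G ω + 1)
  have hBi : Integrable B μ := (hid.const_mul _).add (his.const_mul _)
  have hB0 : ∀ ω, 0 ≤ B ω := fun ω => by
    have h1 : 0 ≤ G ω ^ 2 - 2 * G ω + 1 := by nlinarith [sq_nonneg (G ω - 1)]
    have h2 : 0 ≤ G ω ^ 2 + 2 * G ω + 1 := by nlinarith [sq_nonneg (G ω + 1)]
    simp only [B]
    positivity
  have hle : ∀ ω, G ω ^ 2 - 1 ≤ B ω := fun ω => by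
    have h : B ω - (G ω ^ 2 - 1) = (2 * t)⁻¹ * ((G ω - 1) - t * (G ω + 1)) ^ 2 := by
      simp only [B]
      field_simp
      ring
    have : 0 ≤ (2 * t)⁻¹ * ((G ω - 1) - t * (G ω + 1)) ^ 2 := by positivity
    linarith
  have hBint : ∫ ω, B ω ∂μ = (1 - A) / t + t * (1 + A) := by
    rw [integral_add (hid.const_mul _) (his.const_mul _), integral_const_mul, integral_const_mul,
      hd, hs]
    field_simp
  have key : ∫ ω in D, (G ω ^ 2 - 1) ∂μ ≤ (1 - A) / t + t * (1 + A) := by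
    rw [← hBint]
    calc ∫ ω in D, (G ω ^ 2 - 1) ∂μ ≤ ∫ ω in D, B ω ∂μ :=
          setIntegral_mono (hi2.sub (integrable_const 1)).integrableOn hBi.integrableOn hle
      _ ≤ ∫ ω, B ω ∂μ := setIntegral_le_integral hBi (ae_of_all _ hB0)
  rw [integral_sub hi2.integrableOn (integrable_const 1).integrableOn] at key
  simp only [integral_const, smul_eq_mul, mul_one, measureReal_restrict_apply MeasurableSet.univ,
    univ_inter] at key
  rw [hν]
  nlinarith

/-- Changing finitely many factors of a product measure. -/
lemma infinitePi_withDensity {P : Measure ℝ} [IsProbabilityMeasure P] {d : ℕ → ℝ → ENNReal}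
    (hd : ∀ i, Measurable (d i)) {μ : ℕ → Measure ℝ} [∀ i, IsProbabilityMeasure (μ i)]
    (hμ : ∀ i, μ i = P.withDensity (d i)) {k : ℕ} (hk : ∀ i, k ≤ i → d i = 1) :
    Measure.infinitePi μ = (Measure.infinitePi fun _ : ℕ => P).withDensity
      (fun z => ∏ i ∈ Finset.range k, d i (z i)) := by
  classical
  refine (Measure.eq_infinitePi μ fun s t ht => ?_).symm
  -- On `u` the indicator of the box and the density become one product of functions of single
  -- coordinates. In `s` beyond `k` the density factor is `1`; below `k` outside `s` the factor
  -- integrates to the total mass `1`.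
  set u := s ∪ Finset.range k with hu
  let T : ℕ → Set ℝ := fun i => if i ∈ s then t i else univ
  have hT : ∀ i, MeasurableSet (T i) := fun i => by
    simp only [T]; split_ifs
    exacts [ht i, MeasurableSet.univ]
  have hind : iIndepFun (fun (i : ℕ) (z : ℕ → ℝ) => (T i).indicator (d i) (z i))
      (Measure.infinitePi fun _ : ℕ => P) :=
    iIndepFun_infinitePi (P := fun _ : ℕ => P) fun i => (hd i).indicator (hT i)
  have hX : ∀ i, Measurable fun z : ℕ → ℝ => (T i).indicator (d i) (z i) := fun i =>
    ((hd i).indicator (hT i)).comp (measurable_pi_apply i)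
  have hset : MeasurableSet ((s : Set ℕ).pi t) :=
    MeasurableSet.pi s.countable_toSet fun i _ => ht i
  rw [withDensity_apply _ hset, ← lintegral_indicator hset]
  have hfun : ((s : Set ℕ).pi t).indicator (fun z : ℕ → ℝ => ∏ i ∈ Finset.range k, d i (z i)) =
      fun z => ∏ i ∈ u, (T i).indicator (d i) (z i) := by
    funext z
    by_cases hz : z ∈ (s : Set ℕ).pi t
    · rw [indicator_of_mem hz]
      have h1 : ∀ i ∈ u, (T i).indicator (d i) (z i) = d i (z i) := fun i _ => by
        refine indicator_of_mem ?_ _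
        simp only [T]; split_ifs with hi
        exacts [hz i hi, mem_univ _]
      rw [Finset.prod_congr rfl h1]
      refine Finset.prod_subset Finset.subset_union_right fun i _ hi => ?_
      rw [hk i (by simpa using hi)]
      rfl
    · rw [indicator_of_notMem hz]
      have : ∃ i ∈ s, z i ∉ t i := by
        by_contra! hc
        exact hz fun i hi => hc i hi
      obtain ⟨i, hi, hzi⟩ := this
      refine (Finset.prod_eq_zero (Finset.mem_union_left _ hi) ?_).symm
      refine indicator_of_notMem ?_ _
      simpa only [T, if_pos hi] using hzi
  rw [hfun, lintegral_prod_eq_prod_lintegral_of_indepFun u _ hind hX]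
  have hterm : ∀ i, ∫⁻ z, (T i).indicator (d i) (z i) ∂(Measure.infinitePi fun _ : ℕ => P) =
      μ i (T i) := fun i => by
    rw [hμ i, withDensity_apply _ (hT i), ← lintegral_indicator (hT i)]
    exact (measurePreserving_eval_infinitePi (fun _ : ℕ => P) i).lintegral_comp
      ((hd i).indicator (hT i))
  rw [Finset.prod_congr rfl fun i _ => hterm i]
  symm
  refine (Finset.prod_congr rfl fun i hi => by simp only [T, if_pos hi]).trans
    (Finset.prod_subset (f := fun i => μ i (T i)) Finset.subset_union_left fun i _ hi => ?_)
  simp only [T, if_neg hi, measure_univ]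

/-- Total variation distance of product measures that differ in `k` equal factors. -/
lemma infinitePi_le_of_affinity {P Q : Measure ℝ} [IsProbabilityMeasure P] [IsProbabilityMeasure Q]
    {g : ℝ → ℝ} (hg : Measurable g)
    (hQ : Q = P.withDensity fun x => ENNReal.ofReal (g x ^ 2)) (k : ℕ)
    {μ : ℕ → Measure ℝ} [∀ i, IsProbabilityMeasure (μ i)]
    (hμ : ∀ i, μ i = if i < k then Q else P)
    {D : Set (ℕ → ℝ)} (hD : MeasurableSet D) {t : ℝ} (ht : 0 < t) :
    (Measure.infinitePi μ).real D ≤ (Measure.infinitePi fun _ : ℕ => P).real D +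
      ((1 - (∫ x, g x ∂P) ^ k) / t + 2 * t) := by
  have hpi := infinitePi_withDensity (P := P) (μ := μ) (k := k)
    (d := fun i => if i < k then fun x => ENNReal.ofReal (g x ^ 2) else 1)
    (fun i => by
      split_ifs
      exacts [(hg.pow_const 2).ennreal_ofReal, measurable_one])
    (fun i => by
      rw [hμ i]
      split_ifs
      exacts [hQ, withDensity_one.symm])
    (fun i hi => if_neg (not_lt.2 hi))
  have hdens : (fun z : ℕ → ℝ => ∏ i ∈ Finset.range k,
      (if i < k then fun x => ENNReal.ofReal (g x ^ 2) else 1 : ℝ → ENNReal) (z i)) =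
      fun z => ENNReal.ofReal ((∏ i : Fin k, g (z i)) ^ 2) := by
    funext z
    rw [← Fin.prod_univ_eq_prod_range (fun i => (if i < k then fun x => ENNReal.ofReal (g x ^ 2)
      else 1 : ℝ → ENNReal) (z i)), ← Finset.prod_pow,
      ENNReal.ofReal_prod_of_nonneg fun i _ => sq_nonneg _]
    exact Finset.prod_congr rfl fun i _ => by rw [if_pos i.2]
  rw [hdens] at hpi
  have hprob : IsProbabilityMeasure (Measure.infinitePi μ) := inferInstance
  rw [hpi] at hprob ⊢
  refine (withDensity_sq_le (G := fun z : ℕ → ℝ => ∏ i : Fin k, g (z i))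
    (Finset.measurable_prod _ fun i _ => hg.comp (measurable_pi_apply _))
    hD ht).trans_eq ?_
  have hind : iIndepFun (fun (i : Fin k) (z : ℕ → ℝ) => g (z i))
      (Measure.infinitePi fun _ : ℕ => P) :=
    (iIndepFun_infinitePi (P := fun _ : ℕ => P) (X := fun _ => g) fun _ => hg).precomp
      Fin.val_injective
  have hint := hind.integral_prod_eq_prod_integral
    fun i => (hg.comp (measurable_pi_apply _)).aestronglyMeasurable
  have hone : ∀ i : ℕ, ∫ z : ℕ → ℝ, g (z i) ∂(Measure.infinitePi fun _ : ℕ => P) =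
      ∫ x, g x ∂P := fun i => by
    have hmp := measurePreserving_eval_infinitePi (fun _ : ℕ => P) i
    rw [← hmp.map_eq, integral_map hmp.aemeasurable hg.aestronglyMeasurable]
    simp only [hmp.map_eq]
  simp only [hone, Finset.prod_const, Finset.card_univ, Fintype.card_fin] at hint
  rw [← hint]
  simp only [Finset.prod_apply]

/-! ### The affinity of a density and its stretched version -/

/-- A positive function with second derivative at most `M` on a window of half-width `h` has a
square root with small derivative. -/
lemma abs_deriv_le_of_pos {f f' f'' : ℝ → ℝ} {s h M : ℝ} (hh : 0 < h)
    (hf : ∀ x ∈ Icc (s - h) (s + h), HasDerivAt f (f' x) x)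
    (hf' : ∀ x ∈ Icc (s - h) (s + h), HasDerivAt f' (f'' x) x)
    (hM : ∀ x ∈ Icc (s - h) (s + h), |f'' x| ≤ M)
    (hpos : ∀ x ∈ Icc (s - h) (s + h), 0 < f x) :
    |f' s| ≤ 2 * √(f s) * √(M + f s / h ^ 2) := by
  have hs : s ∈ Icc (s - h) (s + h) := ⟨by linarith, by linarith⟩
  have hM0 : 0 ≤ M := (abs_nonneg _).trans (hM s hs)
  have hfs := hpos s hs
  have hlip : ∀ x ∈ Icc (s - h) (s + h), |f' x - f' s| ≤ M * |x - s| := fun x hx =>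
    (convex_Icc _ _).norm_image_sub_le_of_norm_hasDerivWithin_le
      (fun y hy => (hf' y hy).hasDerivWithinAt) hM hs hx
  -- Mean value inequality for `f x - f' s * x`, whose derivative is at most `M |τ|` on the segment;
  -- the factor `1 / 2` of Taylor's formula is not needed.
  have htaylor : ∀ τ, |τ| ≤ h → f (s + τ) ≤ f s + τ * f' s + M * τ ^ 2 := by
    intro τ hτ
    have hsub : uIcc s (s + τ) ⊆ Icc (s - h) (s + h) := by
      rw [abs_le] at hτ
      exact uIcc_subset_Icc hs ⟨by linarith, by linarith⟩
    have := (convex_uIcc s (s + τ)).norm_image_sub_le_of_norm_hasDerivWithin_le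
      (f := fun x => f x - f' s * x) (f' := fun x => f' x - f' s) (C := M * |τ|)
      (fun y hy => by
        have h2 := ((hf y (hsub hy)).sub ((hasDerivAt_id y).const_mul (f' s))).hasDerivWithinAt
          (s := uIcc s (s + τ))
        rw [mul_one] at h2
        exact h2)
      (fun y hy => (hlip y (hsub hy)).trans (mul_le_mul_of_nonneg_left
        ((abs_sub_left_of_mem_uIcc hy).trans_eq (by rw [add_sub_cancel_left])) hM0)) left_mem_uIcc right_mem_uIcc
    rw [add_sub_cancel_left, Real.norm_eq_abs, Real.norm_eq_abs, mul_assoc,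
      ← sq, sq_abs] at this
    have := (abs_le.1 this).2
    nlinarith
  -- Positivity at `s ± t` forces `t |f' s| ≤ f s + B t²`. The best step is `t = √(f s / B)`; the
  -- term `f s / h²` in `B` keeps it inside the window, `t ≤ h`.
  set B := M + f s / h ^ 2 with hB
  have hB0 : 0 < B := by positivity
  set t := √(f s) / √B with ht
  have ht0 : 0 < t := by positivity
  have hth : t ≤ h := by
    rw [ht, div_le_iff₀ (by positivity)]
    refine Real.sqrt_le_iff.2 ⟨by positivity, ?_⟩
    rw [mul_pow, Real.sq_sqrt hB0.le, hB, mul_add, mul_div_cancel₀ _ (by positivity)]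
    nlinarith [mul_nonneg (sq_nonneg h) hM0]
  have hbound : t * |f' s| ≤ f s + B * t ^ 2 := by
    have h1 := htaylor t (by rwa [abs_of_pos ht0])
    have h2 := htaylor (-t) (by rwa [abs_neg, abs_of_pos ht0])
    have h3 := hpos (s + t) ⟨by linarith, by linarith⟩
    have h4 := hpos (s + -t) ⟨by linarith, by linarith⟩
    have h5 : M * t ^ 2 ≤ B * t ^ 2 := by
      gcongr
      have : 0 < f s / h ^ 2 := by positivity
      linarith
    rcases abs_cases (f' s) with ⟨h, _⟩ | ⟨h, _⟩ <;> rw [h] <;> nlinarith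
  have hsB : √B * √B = B := Real.mul_self_sqrt hB0.le
  have hsf : √(f s) * √(f s) = f s := Real.mul_self_sqrt hfs.le
  have ht2 : B * t ^ 2 = f s := by
    rw [ht, div_pow, Real.sq_sqrt hB0.le, Real.sq_sqrt hfs.le]
    field_simp
  rw [ht2] at hbound
  have h6 : t * (2 * √(f s) * √B) = f s + f s := by
    rw [ht]
    field_simp
    rw [Real.sq_sqrt hfs.le]
    ring
  exact le_of_mul_le_mul_left (by rw [h6]; exact hbound) ht0

/-- The square root of a positive function with bounded second derivative is Lipschitz. -/
lemma abs_sqrt_sub_sqrt_le {f f' f'' : ℝ → ℝ} {a b h M K : ℝ} (hh : 0 < h) (hab : a ≤ b)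
    (hf : ∀ x ∈ Icc (a - h) (b + h), HasDerivAt f (f' x) x)
    (hf' : ∀ x ∈ Icc (a - h) (b + h), HasDerivAt f' (f'' x) x)
    (hM : ∀ x ∈ Icc (a - h) (b + h), |f'' x| ≤ M)
    (hpos : ∀ x ∈ Icc (a - h) (b + h), 0 < f x)
    (hK : ∀ x ∈ Icc a b, M + f x / h ^ 2 ≤ K) :
    (√(f b) - √(f a)) ^ 2 ≤ K * (b - a) ^ 2 := by
  have hsub : ∀ x ∈ Icc a b, Icc (x - h) (x + h) ⊆ Icc (a - h) (b + h) := fun x hx =>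
    Icc_subset_Icc (by linarith [hx.1]) (by linarith [hx.2])
  have hmem : ∀ x ∈ Icc a b, x ∈ Icc (a - h) (b + h) := fun x hx =>
    ⟨by linarith [hx.1], by linarith [hx.2]⟩
  have hbd : ∀ x ∈ Icc a b, ‖f' x / (2 * √(f x))‖ ≤ √K := fun x hx => by
    have h1 := abs_deriv_le_of_pos hh (fun y hy => hf y (hsub x hx hy))
      (fun y hy => hf' y (hsub x hx hy)) (fun y hy => hM y (hsub x hx hy))
      (fun y hy => hpos y (hsub x hx hy))
    have h2 := Real.sqrt_pos.2 (hpos x (hmem x hx))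
    rw [Real.norm_eq_abs, abs_div, abs_of_pos (by positivity : 0 < 2 * √(f x)),
      div_le_iff₀ (by positivity), mul_comm]
    exact h1.trans (by gcongr; exact hK x hx)
  have h3 := (convex_Icc a b).norm_image_sub_le_of_norm_hasDerivWithin_le
    (fun x hx => ((hf x (hmem x hx)).sqrt (hpos x (hmem x hx)).ne').hasDerivWithinAt) hbd
    (left_mem_Icc.2 hab) (right_mem_Icc.2 hab)
  have hK0 : 0 ≤ K := by
    have h4 := hmem a (left_mem_Icc.2 hab)
    have h5 := (abs_nonneg _).trans (hM a h4)
    have h6 := hpos a h4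
    exact le_trans (by positivity) (hK a (left_mem_Icc.2 hab))
  rw [Real.norm_eq_abs, Real.norm_eq_abs] at h3
  have h4 := pow_le_pow_left₀ (abs_nonneg _) h3 2
  rwa [sq_abs, mul_pow, sq_abs, Real.sq_sqrt hK0] at h4

namespace IPDDensity

variable (p : IPDDensity)

lemma pMinus_pos {x r : ℝ} (hx : 0 < x) (hr : r < 1) : 0 < p.pMinus x r :=
  mul_pos (by linarith) (p.pdf_pos _ (mul_pos (by linarith) hx))

lemma integrableOn_pMinus {r : ℝ} (hr : r < 1) : IntegrableOn (fun x => p.pMinus x r) (Ioi 0) := by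
  have h := (integrableOn_Ioi_comp_mul_left_iff p.pdf 0 (by linarith : 0 < 1 - r)).2
    (by simpa using p.integrableOn_pdf)
  exact h.const_mul _

lemma integral_pMinus {r : ℝ} (hr : r < 1) : ∫ x in Ioi (0 : ℝ), p.pMinus x r = 1 := by
  have h := integral_comp_mul_left_Ioi p.pdf 0 (by linarith : 0 < 1 - r)
  simp only [pMinus]
  rw [integral_const_mul, h, mul_zero, p.integral_pdf, smul_eq_mul, mul_one,
    mul_inv_cancel₀ (by linarith)]

variable {p}

/-- Regularity is stated for `log p⁻`; since `p⁻ > 0`, it passes to `p⁻ = exp (log p⁻)`. -/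
lemma Regular.hasDerivAt_pMinus (hp : p.Regular) {x : ℝ} (hx : 0 < x) {r : ℝ}
    (hr : r ∈ Ioo (0 : ℝ) 1) :
    HasDerivAt (fun r => p.pMinus x r) (deriv (fun r => p.pMinus x r) r) r ∧
    HasDerivAt (deriv fun r => p.pMinus x r) (iteratedDeriv 2 (fun r => p.pMinus x r) r) r := by
  set f : ℝ → ℝ := fun r => p.pMinus x r with hf
  set l : ℝ → ℝ := fun r => Real.log (f r) with hl
  have hl0 : ∀ s ∈ Ioo (0 : ℝ) 1, DifferentiableAt ℝ l s := fun s hs => by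
    simpa using hp.exists_derivs x hx s hs 0 (by norm_num)
  have hl1 : ∀ s ∈ Ioo (0 : ℝ) 1, DifferentiableAt ℝ (deriv l) s := fun s hs => by
    simpa using hp.exists_derivs x hx s hs 1 (by norm_num)
  have hexp : ∀ s ∈ Ioo (0 : ℝ) 1, f =ᶠ[𝓝 s] fun r => Real.exp (l r) := fun s hs => by
    filter_upwards [Ioo_mem_nhds hs.1 hs.2] with r hr
    exact (Real.exp_log (p.pMinus_pos hx hr.2)).symm
  have h1 : ∀ s ∈ Ioo (0 : ℝ) 1, HasDerivAt f (f s * deriv l s) s := fun s hs => by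
    have h := ((hl0 s hs).hasDerivAt.exp).congr_of_eventuallyEq (hexp s hs)
    have he : f s = Real.exp (l s) := (hexp s hs).self_of_nhds
    rwa [← he] at h
  have h2 : deriv f =ᶠ[𝓝 r] fun s => f s * deriv l s := by
    filter_upwards [Ioo_mem_nhds hr.1 hr.2] with s hs
    exact (h1 s hs).deriv
  refine ⟨(h1 r hr).differentiableAt.hasDerivAt, ?_⟩
  rw [iteratedDeriv_succ, iteratedDeriv_one]
  exact (((h1 r hr).differentiableAt.mul (hl1 r hr)).congr_of_eventuallyEq h2).hasDerivAt

/-- Varying `ρ` at fixed `x` moves the argument of `pdf`, so smoothness in `ρ` yields continuity in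
the argument. With `x = 2 y`, the point `y` corresponds to the interior value `ρ = 1 / 2`. Serves
the measurability of `sqrtRatio`. -/
lemma Regular.continuousOn_pdf (hp : p.Regular) : ContinuousOn p.pdf (Ioi 0) := by
  intro y hy
  have hy : 0 < y := hy
  refine ContinuousAt.continuousWithinAt ?_
  have h := (hp.hasDerivAt_pMinus (x := 2 * y) (by linarith)
    (r := 1 / 2) (by norm_num)).1.continuousAt
  have hr : ContinuousAt (fun u : ℝ => 1 - u / (2 * y)) y := by fun_prop
  have he : 1 - y / (2 * y) = 1 / 2 := by field_simp; norm_num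
  have hc : ContinuousAt (fun u : ℝ => p.pMinus (2 * y) (1 - u / (2 * y)) / (u / (2 * y))) y :=
    ContinuousAt.div (ContinuousAt.comp_of_eq h hr he) (by fun_prop) (by positivity)
  refine hc.congr ?_
  filter_upwards [Ioi_mem_nhds hy] with u hu
  have hu : 0 < u := hu
  simp only [pMinus, sub_sub_cancel]
  rw [mul_div_cancel_left₀ _ (by positivity), div_mul_cancel₀ _ (by positivity)]

/-- The square root of the likelihood ratio of the stretched and the original density. -/
noncomputable def sqrtRatio (p : IPDDensity) (ρ x : ℝ) : ℝ :=
  (Ioi (0 : ℝ)).indicator (fun x => √(p.pMinus x ρ / p.pdf x)) x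

lemma Regular.measurable_sqrtRatio (hp : p.Regular) {ρ : ℝ} (hρ : ρ < 1) :
    Measurable (p.sqrtRatio ρ) := by
  have hc : ContinuousOn (fun x => √(p.pMinus x ρ / p.pdf x)) (Ioi 0) := by
    have h1 : ContinuousOn (fun x => p.pdf ((1 - ρ) * x)) (Ioi 0) :=
      hp.continuousOn_pdf.comp (by fun_prop) fun x hx => mul_pos (sub_pos.2 hρ) hx
    exact ((continuousOn_const.mul h1).div hp.continuousOn_pdf
      fun x hx => (p.pdf_pos x hx).ne').sqrt
  classical
  have h := hc.measurable_piecewise (g := 0) continuousOn_const measurableSet_Ioi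
  rwa [piecewise_eq_indicator] at h

lemma pdf_mul_sqrtRatio_sq {ρ : ℝ} (hρ : ρ < 1) {x : ℝ} (hx : 0 < x) :
    p.pdf x * p.sqrtRatio ρ x ^ 2 = p.pMinus x ρ := by
  rw [sqrtRatio, indicator_of_mem (mem_Ioi.2 hx), Real.sq_sqrt
    (div_nonneg (p.pMinus_pos hx hρ).le (p.pdf_pos x hx).le), mul_div_cancel₀ _ (p.pdf_pos x hx).ne']

lemma map_div_law {ρ : ℝ} (hρ : ρ < 1) :
    p.law.map (fun x => x / (1 - ρ)) =
      p.law.withDensity (fun x => ENNReal.ofReal (p.sqrtRatio ρ x ^ 2)) := by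
  have hρ' : 0 < 1 - ρ := by linarith
  have hm : Measurable fun x : ℝ => x / (1 - ρ) := measurable_id.div_const _
  have hi : Integrable (fun x => p.sqrtRatio ρ x ^ 2) p.law := by
    rw [integrable_law_iff]
    exact (p.integrableOn_pMinus hρ).congr_fun
      (fun x hx => (pdf_mul_sqrtRatio_sq hρ hx).symm) measurableSet_Ioi
  ext s hs
  have h0 : ∀ x, p.sqrtRatio ρ x ^ 2 * s.indicator 1 x = s.indicator
      (fun x => p.sqrtRatio ρ x ^ 2) x := fun x => by by_cases h : x ∈ s <;> simp [h]
  have h1 : ∫ x, s.indicator (1 : ℝ → ℝ) (x / (1 - ρ)) ∂p.law =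
      ∫ x, p.sqrtRatio ρ x ^ 2 * s.indicator 1 x ∂p.law := by
    rw [integral_law, integral_law]
    have h := integral_comp_mul_left_Ioi
      (fun y => p.pdf y * s.indicator (1 : ℝ → ℝ) (y / (1 - ρ))) 0 hρ'
    rw [mul_zero, smul_eq_mul, eq_inv_mul_iff_mul_eq₀ hρ'.ne', ← integral_const_mul] at h
    rw [← h]
    refine setIntegral_congr_fun measurableSet_Ioi fun x hx => ?_
    rw [mul_div_cancel_left₀ _ hρ'.ne', ← mul_assoc, ← mul_assoc, pdf_mul_sqrtRatio_sq hρ hx]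
    rfl
  have h2 : ∫ x, s.indicator (1 : ℝ → ℝ) (x / (1 - ρ)) ∂p.law =
      (p.law.map fun x => x / (1 - ρ)).real s := by
    rw [← integral_indicator_one hs, integral_map hm.aemeasurable
      (measurable_one.indicator hs).aestronglyMeasurable]
  have h3 : ENNReal.ofReal (∫ x, p.sqrtRatio ρ x ^ 2 * s.indicator 1 x ∂p.law) =
      p.law.withDensity (fun x => ENNReal.ofReal (p.sqrtRatio ρ x ^ 2)) s := by
    simp only [h0]
    rw [integral_indicator hs, withDensity_apply _ hs,
      ofReal_integral_eq_lintegral_ofReal hi.integrableOn (ae_of_all _ fun x => sq_nonneg _)]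
  have hfin : IsFiniteMeasure (p.law.map fun x => x / (1 - ρ)) := inferInstance
  rw [← h3, ← h1, h2, measureReal_def, ENNReal.ofReal_toReal (measure_ne_top _ _)]

/-- The Lipschitz bound for square roots needs a two-sided window in `ρ`, and the domination holds
only on `(0, δ)`. Stretchings compose, and Hellinger distance is invariant under scaling, so the
pair of parameters `0, ρ` may be replaced by `a, b` with `1 - b = (1 - a)(1 - ρ)` around `a = δ /
2`. -/
lemma Regular.hellinger_le (hp : p.Regular) : ∃ C η : ℝ, 0 ≤ C ∧ 0 < η ∧ η ≤ 1 ∧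
    ∀ ρ ∈ Ioo (0 : ℝ) η, ∫ x in Ioi (0 : ℝ), (√(p.pMinus x ρ) - √(p.pdf x)) ^ 2 ≤ C * ρ ^ 2 := by
  obtain ⟨δ, ⟨hδ0, hδ1⟩, F, G, H, hF, hG, -, hdom⟩ := hp.dominated
  -- The constant `M + f / h²` of the Lipschitz bound with `M = G x` and `h = δ / 8`, where `p⁻(x,
  -- s) ≤ p⁻(x, δ / 2) + F x * δ`; it is integrable in `x`. With `ρ < δ / 4` the window lies in `[3
  -- δ / 8, 7 δ / 8]`.
  set K : ℝ → ℝ := fun x => G x + (p.pMinus x (δ / 2) + F x * δ) / (δ / 8) ^ 2 with hK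
  have hKi : IntegrableOn K (Ioi 0) :=
    hG.add (((p.integrableOn_pMinus (by linarith)).add (hF.mul_const δ)).div_const _)
  have hK0 : ∀ x ∈ Ioi (0 : ℝ), 0 ≤ K x := fun x hx => by
    obtain ⟨h1, h2, -⟩ := hdom x hx (δ / 2) ⟨by linarith, by linarith⟩
    have h3 := (abs_nonneg _).trans h1.le
    have h4 := (abs_nonneg _).trans h2.le
    have h5 := p.pMinus_pos (x := x) hx (by linarith : δ / 2 < 1)
    positivity
  refine ⟨∫ x in Ioi (0 : ℝ), K x, δ / 4, setIntegral_nonneg measurableSet_Ioi hK0, by linarith,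
    by linarith, fun ρ hρ => ?_⟩
  set a := δ / 2 with ha
  set b := a + ρ * (1 - a) with hb
  have hab : a ≤ b := by
    have : 0 ≤ ρ * (1 - a) := mul_nonneg hρ.1.le (by linarith)
    linarith
  have hb' : b ≤ a + δ / 4 := by
    have : ρ * (1 - a) ≤ δ / 4 * 1 := by gcongr <;> linarith [hρ.2]
    linarith
  have ha1 : 0 < 1 - a := by linarith
  have hwin : ∀ s ∈ Icc (a - δ / 8) (b + δ / 8), s ∈ Ioo 0 δ := fun s hs =>
    ⟨by linarith [hs.1], by linarith [hs.2]⟩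
  have hwin1 : ∀ s ∈ Icc (a - δ / 8) (b + δ / 8), s ∈ Ioo (0 : ℝ) 1 := fun s hs =>
    ⟨(hwin s hs).1, (hwin s hs).2.trans_le hδ1⟩
  have hpt : ∀ x ∈ Ioi (0 : ℝ), (√(p.pMinus x b) - √(p.pMinus x a)) ^ 2 ≤ K x * ρ ^ 2 := by
    intro x hx
    have hlip : ∀ s ∈ Icc a b, p.pMinus x s ≤ p.pMinus x a + F x * δ := fun s hs => by
      have h := (convex_Icc a b).norm_image_sub_le_of_norm_hasDerivWithin_le (C := F x)
        (fun r hr => (hp.hasDerivAt_pMinus hx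
          (hwin1 r ⟨by linarith [hr.1], by linarith [hr.2]⟩)).1.hasDerivWithinAt)
        (fun r hr => (hdom x hx r (hwin r ⟨by linarith [hr.1], by linarith [hr.2]⟩)).1.le)
        (left_mem_Icc.2 hab) hs
      have hF0 : 0 ≤ F x := (abs_nonneg _).trans (hdom x hx a (hwin a ⟨by linarith,
        by linarith⟩)).1.le
      have h2 : ‖s - a‖ ≤ δ := by
        rw [Real.norm_eq_abs, abs_of_nonneg (by linarith [hs.1])]
        linarith [hs.2]
      have h3 := (abs_le.1 (h.trans (mul_le_mul_of_nonneg_left h2 hF0))).2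
      linarith
    have h := abs_sqrt_sub_sqrt_le (K := K x) (M := G x) (by linarith : 0 < δ / 8) hab
      (fun s hs => (hp.hasDerivAt_pMinus hx (hwin1 s hs)).1)
      (fun s hs => (hp.hasDerivAt_pMinus hx (hwin1 s hs)).2)
      (fun s hs => (hdom x hx s (hwin s hs)).2.1.le)
      (fun s hs => p.pMinus_pos hx (hwin1 s hs).2)
      (fun s hs => by
        have := hlip s hs
        simp only [hK]
        gcongr)
    refine h.trans ?_
    have h4 : (b - a) ^ 2 ≤ ρ ^ 2 := by
      rw [hb, add_sub_cancel_left]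
      refine pow_le_pow_left₀ (mul_nonneg hρ.1.le ha1.le) ?_ 2
      nlinarith [hρ.1]
    exact mul_le_mul_of_nonneg_left h4 (hK0 x hx)
  have hscale : ∀ x : ℝ, (√(p.pMinus x b) - √(p.pMinus x a)) ^ 2 =
      (1 - a) * (fun y => (√(p.pMinus y ρ) - √(p.pdf y)) ^ 2) ((1 - a) * x) := fun x => by
    have e1 : p.pMinus x b = (1 - a) * p.pMinus ((1 - a) * x) ρ := by
      simp only [pMinus]
      have : 1 - b = (1 - a) * (1 - ρ) := by rw [hb]; ring
      rw [this, mul_assoc, show (1 - a) * (1 - ρ) * x = (1 - ρ) * ((1 - a) * x) by ring]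
    have e2 : p.pMinus x a = (1 - a) * p.pdf ((1 - a) * x) := rfl
    rw [e1, e2, Real.sqrt_mul ha1.le, Real.sqrt_mul ha1.le, ← mul_sub, mul_pow,
      Real.sq_sqrt ha1.le]
  have hint : ∫ x in Ioi (0 : ℝ), (√(p.pMinus x b) - √(p.pMinus x a)) ^ 2 =
      ∫ x in Ioi (0 : ℝ), (√(p.pMinus x ρ) - √(p.pdf x)) ^ 2 := by
    simp only [hscale]
    rw [integral_const_mul, integral_comp_mul_left_Ioi
      (fun y => (√(p.pMinus y ρ) - √(p.pdf y)) ^ 2) 0 ha1, mul_zero, smul_eq_mul,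
      mul_inv_cancel_left₀ ha1.ne']
  rw [← hint, ← integral_mul_const]
  exact integral_mono_of_nonneg (ae_of_all _ fun x => sq_nonneg _) (hKi.mul_const _)
    ((ae_restrict_iff' measurableSet_Ioi).2 (ae_of_all _ hpt))

/-- The identity `√(p q) = (p + q - (√p - √q)²) / 2`, integrated: affinity is one minus half the
squared Hellinger distance. -/
lemma Regular.affinity_ge (hp : p.Regular) : ∃ C η : ℝ, 0 ≤ C ∧ 0 < η ∧ η ≤ 1 ∧
    ∀ ρ ∈ Ioo (0 : ℝ) η, 1 - C * ρ ^ 2 ≤ ∫ x, p.sqrtRatio ρ x ∂p.law := by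
  obtain ⟨C, η, hC, hη, hη1, h⟩ := hp.hellinger_le
  refine ⟨C / 2, η, by positivity, hη, hη1, fun ρ hρ => ?_⟩
  have hρ1 : ρ < 1 := hρ.2.trans_le hη1
  have hpt : ∀ x ∈ Ioi (0 : ℝ), p.pdf x * p.sqrtRatio ρ x =
      (p.pMinus x ρ + p.pdf x - (√(p.pMinus x ρ) - √(p.pdf x)) ^ 2) / 2 := fun x hx => by
    have hx0 := p.pdf_pos x hx
    have hx1 := p.pMinus_pos hx hρ1
    rw [sqrtRatio, indicator_of_mem hx, Real.sqrt_div hx1.le, sub_sq, Real.sq_sqrt hx1.le,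
      Real.sq_sqrt hx0.le]
    have : √(p.pdf x) ≠ 0 := (Real.sqrt_pos.2 hx0).ne'
    field_simp
    nth_rewrite 1 [← Real.sq_sqrt hx0.le]
    ring
  have hi : Integrable (fun x => (√(p.pMinus x ρ) - √(p.pdf x)) ^ 2)
      (volume.restrict (Ioi (0 : ℝ))) := by
    have hm : AEStronglyMeasurable (fun x => (√(p.pMinus x ρ) - √(p.pdf x)) ^ 2)
        (volume.restrict (Ioi (0 : ℝ))) :=
      (((p.integrableOn_pMinus hρ1).aestronglyMeasurable.aemeasurable.sqrt.sub
        p.integrableOn_pdf.aestronglyMeasurable.aemeasurable.sqrt).pow_const 2).aestronglyMeasurable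
    refine Integrable.mono' ((p.integrableOn_pMinus hρ1).add p.integrableOn_pdf) hm ?_
    refine (ae_restrict_iff' measurableSet_Ioi).2 (ae_of_all _ fun x hx => ?_)
    rw [Real.norm_eq_abs, abs_of_nonneg (sq_nonneg _), sub_sq,
      Real.sq_sqrt (p.pMinus_pos hx hρ1).le, Real.sq_sqrt (p.pdf_pos x hx).le]
    have : 0 ≤ √(p.pMinus x ρ) * √(p.pdf x) := by positivity
    simp only [Pi.add_apply]
    linarith
  have hs : Integrable (fun x => p.pMinus x ρ + p.pdf x) (volume.restrict (Ioi (0 : ℝ))) :=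
    (p.integrableOn_pMinus hρ1).add p.integrableOn_pdf
  rw [integral_law, setIntegral_congr_fun measurableSet_Ioi hpt, integral_div,
    integral_sub hs hi, integral_add (p.integrableOn_pMinus hρ1) p.integrableOn_pdf,
    p.integral_pMinus hρ1, p.integral_pdf]
  linarith [h ρ hρ]

end IPDDensity

/-! ### The two-phase scheme -/

/-- The end of the first phase. -/
noncomputable def phaseEnd (k : ℕ) (ρ : ℝ) (x : ℕ → ℝ) : ℝ := timeOf x k / (1 - ρ)

/-- The number of replaced packets: `j` if Bob's buffer holds `j` packets at the end of the first
phase, and none otherwise. -/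
noncomputable def replaced (k j : ℕ) (ρ : ℝ) (x : ℕ → ℝ) : ℕ :=
  if timeOf x (k + j) ≤ phaseEnd k ρ x then j else 0

/-- Alice replaces the first `j` packets after the first phase, if Bob's buffer is full enough. -/
def IsReplaced (k j : ℕ) (ρ : ℝ) (x : ℕ → ℝ) (n : ℕ) : Prop :=
  phaseEnd k ρ x < x n ∧ timeOf x (k + j) ≤ phaseEnd k ρ x ∧ x (n - j) ≤ phaseEnd k ρ x

open Classical in
/-- Alice's output. -/
noncomputable def twoPhaseAlice (k j : ℕ) (ρ : ℝ) (x : ℕ → ℝ) : LabelledStream :=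
  fun n => (x n, decide (IsReplaced k j ρ x n))

/-- Bob's output as a function of the packet times that he sees. -/
noncomputable def twoPhaseBob (k j : ℕ) (ρ : ℝ) (x : ℕ → ℝ) (n : ℕ) : ℝ :=
  if n < k then x n / (1 - ρ)
  else x (n + replaced k j ρ x) + (phaseEnd k ρ x - timeOf x (k + replaced k j ρ x))

lemma twoPhaseAlice_snd {k j : ℕ} {ρ : ℝ} {x : ℕ → ℝ} {n : ℕ} :
    (twoPhaseAlice k j ρ x n).2 = true ↔ IsReplaced k j ρ x n := by
  simp [twoPhaseAlice]

lemma IsStream.pos {x : ℕ → ℝ} (hx : IsStream x) (n : ℕ) : 0 < x n :=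
  hx.2.1.trans_le (hx.1.monotone n.zero_le)

lemma IsStream.timeOf_nonneg {x : ℕ → ℝ} (hx : IsStream x) (n : ℕ) : 0 ≤ timeOf x n := by
  cases n
  exacts [le_rfl, (hx.pos _).le]

lemma IsStream.timeOf_le {x : ℕ → ℝ} (hx : IsStream x) {m n : ℕ} (h : m ≤ n) :
    timeOf x m ≤ x n :=
  hx.timeOf_strictMono.monotone (h.trans n.le_succ)

lemma le_div_one_sub {a ρ : ℝ} (hρ : ρ ∈ Ioo (0 : ℝ) 1) (ha : 0 ≤ a) : a ≤ a / (1 - ρ) := by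
  rw [le_div_iff₀ (by linarith [hρ.2])]
  nlinarith [hρ.1]

section

variable {k j : ℕ} {ρ : ℝ} {x x' : ℕ → ℝ}

lemma timeOf_le_phaseEnd (hρ : ρ ∈ Ioo (0 : ℝ) 1) (hx : IsStream x) :
    timeOf x k ≤ phaseEnd k ρ x :=
  le_div_one_sub hρ (hx.timeOf_nonneg k)

lemma timeOf_replaced_le (hρ : ρ ∈ Ioo (0 : ℝ) 1) (hx : IsStream x) :
    timeOf x (k + replaced k j ρ x) ≤ phaseEnd k ρ x := by
  unfold replaced
  split_ifs with h
  exacts [h, timeOf_le_phaseEnd hρ hx]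

/-- The replaced packets are consecutive. -/
lemma exists_isReplaced_iff (hρ : ρ ∈ Ioo (0 : ℝ) 1) (hx : IsStream x) :
    ∃ m, k + replaced k j ρ x ≤ m ∧ (∀ i, m ≤ i ↔ phaseEnd k ρ x < x i) ∧
      ∀ i, IsReplaced k j ρ x i ↔ m ≤ i ∧ i < m + replaced k j ρ x := by
  classical
  have hex : ∃ m, phaseEnd k ρ x < x m := (hx.2.2.eventually_gt_atTop _).exists
  have hm : ∀ i, Nat.find hex ≤ i ↔ phaseEnd k ρ x < x i := fun i =>
    ⟨fun h => (Nat.find_spec hex).trans_le (hx.1.monotone h), fun h => Nat.find_min' hex h⟩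
  have hkm : k + replaced k j ρ x ≤ Nat.find hex := by
    by_contra! hc
    exact absurd (Nat.find_spec hex) (not_lt.2 ((hx.timeOf_strictMono.monotone hc).trans
      (timeOf_replaced_le hρ hx)))
  -- The witness is the first packet after the first phase. Since `k + J ≤ m` for the actual number
  -- `J` of replaced packets, the truncated subtraction `i - j` does no harm.
  refine ⟨Nat.find hex, hkm, hm, fun i => ?_⟩
  unfold IsReplaced
  have h3 : x (i - j) ≤ phaseEnd k ρ x ↔ i - j < Nat.find hex := by
    rw [← not_lt, ← hm, not_le]
  rw [← hm i, h3]
  by_cases hE : timeOf x (k + j) ≤ phaseEnd k ρ x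
  · have hj : replaced k j ρ x = j := if_pos hE
    rw [hj] at hkm ⊢
    simp only [hE, true_and]
    omega
  · have hj : replaced k j ρ x = 0 := if_neg hE
    rw [hj]
    simp only [hE, false_and, and_false, false_iff]
    omega

lemma jackAmong_of_consecutive {y : LabelledStream} {m J : ℕ}
    (hy : ∀ i, (y i).2 = true ↔ m ≤ i ∧ i < m + J) (n : ℕ) :
    jackAmong y n = if n ≤ m then n else if n ≤ m + J then m else n - J := by
  unfold jackAmong
  induction n with
  | zero => simp
  | succ n ih =>
    rw [Nat.count_succ, ih]
    have : (y n).2 = false ↔ ¬ (m ≤ n ∧ n < m + J) := by rw [← hy, Bool.not_eq_true]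
    simp only [this]
    split_ifs <;> omega

lemma AgreeUpTo.symm {t : ℝ} (h : AgreeUpTo t x x') : AgreeUpTo t x' x :=
  fun n hn => (h n hn.symm).symm

lemma AgreeUpTo.timeOf_eq {t : ℝ} (h : AgreeUpTo t x x') {m : ℕ} (hm : timeOf x m ≤ t) :
    timeOf x' m = timeOf x m := by
  cases m with
  | zero => rfl
  | succ m => exact (h m (Or.inl hm)).symm

lemma AgreeUpTo.phaseEnd_eq {t : ℝ} (h : AgreeUpTo t x x') (hρ : ρ ∈ Ioo (0 : ℝ) 1)
    (hx : IsStream x) (ht : phaseEnd k ρ x ≤ t) : phaseEnd k ρ x' = phaseEnd k ρ x := by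
  unfold phaseEnd
  rw [h.timeOf_eq ((timeOf_le_phaseEnd hρ hx).trans ht)]

/-- All times that enter the decision on packet `n` are at most `x n`; for this reason "among the
first `j`" is expressed through the past packet `n - j`. -/
lemma AgreeUpTo.isReplaced {t : ℝ} (h : AgreeUpTo t x x') (hρ : ρ ∈ Ioo (0 : ℝ) 1)
    (hx : IsStream x) {n : ℕ} (hn : x n ≤ t) (hr : IsReplaced k j ρ x n) :
    IsReplaced k j ρ x' n := by
  obtain ⟨h1, h2, h3⟩ := hr
  have ht : phaseEnd k ρ x ≤ t := h1.le.trans hn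
  unfold IsReplaced
  rw [h.phaseEnd_eq hρ hx ht, h.timeOf_eq (h2.trans ht), ← h n (Or.inl hn),
    ← h (n - j) (Or.inl (h3.trans ht))]
  exact ⟨h1, h2, h3⟩

lemma le_twoPhaseBob (hρ : ρ ∈ Ioo (0 : ℝ) 1) (hx : IsStream x) {n : ℕ} (hn : k ≤ n) :
    x (n + replaced k j ρ x) ≤ twoPhaseBob k j ρ x n := by
  rw [twoPhaseBob, if_neg (not_lt.2 hn)]
  linarith [timeOf_replaced_le (k := k) (j := j) hρ hx]

lemma phaseEnd_le_twoPhaseBob (hx : IsStream x) {n : ℕ} (hn : k ≤ n) :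
    phaseEnd k ρ x ≤ twoPhaseBob k j ρ x n := by
  rw [twoPhaseBob, if_neg (not_lt.2 hn)]
  linarith [hx.timeOf_le (by omega : k + replaced k j ρ x ≤ n + replaced k j ρ x)]

/-- In the second phase Bob sends neither before the end of the first phase nor before `x (n + J)`,
where `J` is the number of replaced packets, so all that his output uses has already been seen. -/
lemma AgreeUpTo.twoPhaseBob_eq {t : ℝ} (h : AgreeUpTo t x x') (hρ : ρ ∈ Ioo (0 : ℝ) 1)
    (hx : IsStream x) {n : ℕ} (hn : twoPhaseBob k j ρ x n ≤ t) :
    twoPhaseBob k j ρ x n = twoPhaseBob k j ρ x' n := by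
  rcases lt_or_ge n k with hk | hk
  · rw [twoPhaseBob, if_pos hk] at hn
    rw [twoPhaseBob, twoPhaseBob, if_pos hk, if_pos hk,
      h n (Or.inl ((le_div_one_sub hρ (hx.pos n).le).trans hn))]
  · have ht : phaseEnd k ρ x ≤ t := (phaseEnd_le_twoPhaseBob hx hk).trans hn
    have hT := h.phaseEnd_eq hρ hx ht
    have hJ : replaced k j ρ x' = replaced k j ρ x := by
      unfold replaced
      rw [hT]
      by_cases hE : timeOf x (k + j) ≤ phaseEnd k ρ x
      · rw [h.timeOf_eq (hE.trans ht)]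
      · rw [if_neg hE, if_neg]
        intro hE'
        rw [← h.symm.timeOf_eq (hE'.trans ht)] at hE'
        exact hE hE'
    have h1 := h.timeOf_eq ((timeOf_replaced_le (k := k) (j := j) hρ hx).trans ht)
    have h2 := h _ (Or.inl ((le_twoPhaseBob (j := j) hρ hx hk).trans hn))
    rw [twoPhaseBob, twoPhaseBob, if_neg (not_lt.2 hk), if_neg (not_lt.2 hk), hJ, hT, h1, h2]

lemma timeOf_twoPhaseBob_of_le {n : ℕ} (hn : n ≤ k) :
    timeOf (twoPhaseBob k j ρ x) n = timeOf x n / (1 - ρ) := by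
  cases n with
  | zero => simp [timeOf]
  | succ n => exact if_pos hn

lemma timeOf_twoPhaseBob_of_ge {n : ℕ} (hn : k ≤ n) :
    timeOf (twoPhaseBob k j ρ x) n = timeOf x (n + replaced k j ρ x) +
      (phaseEnd k ρ x - timeOf x (k + replaced k j ρ x)) := by
  rcases hn.eq_or_lt with rfl | hn
  · rw [timeOf_twoPhaseBob_of_le le_rfl, phaseEnd]
    ring
  · obtain ⟨n, rfl⟩ : ∃ i, n = i + 1 := ⟨n - 1, by omega⟩
    rw [show n + 1 + replaced k j ρ x = n + replaced k j ρ x + 1 by ring]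
    exact if_neg (by omega)

lemma delays_eq (t : ℕ → ℝ) (n : ℕ) : delays t n = timeOf t (n + 1) - timeOf t n := by
  cases n <;> simp [delays, timeOf]

/-- The constant delay is chosen so that packet index `k + J` of Jack continues exactly from the end
of the first phase: the delay at the junction is again one of Jack's, with no boundary term. -/
lemma delays_twoPhaseBob (z : ℕ → ℝ) (n : ℕ) :
    delays (twoPhaseBob k j ρ (arrivals z)) n =
      if n < k then z n / (1 - ρ) else z (n + replaced k j ρ (arrivals z)) := by
  rw [delays_eq]
  split_ifs with h
  · rw [timeOf_twoPhaseBob_of_le h, timeOf_twoPhaseBob_of_le h.le, timeOf_arrivals,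
      timeOf_arrivals, Finset.sum_range_succ]
    ring
  · rw [timeOf_twoPhaseBob_of_ge (by omega), timeOf_twoPhaseBob_of_ge (by omega),
      show n + 1 + replaced k j ρ (arrivals z) = n + replaced k j ρ (arrivals z) + 1 by ring,
      timeOf_arrivals _ (_ + 1), timeOf_arrivals _ (n + _), Finset.sum_range_succ]
    ring

lemma twoPhaseBob_mono (hρ : ρ ∈ Ioo (0 : ℝ) 1) (hx : IsStream x) :
    Monotone (twoPhaseBob k j ρ x) := by
  have h : Monotone (timeOf (twoPhaseBob k j ρ x)) := by
    refine monotone_nat_of_le_succ fun n => ?_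
    have hmono := hx.timeOf_strictMono.monotone
    rcases lt_or_ge n k with hn | hn
    · rw [timeOf_twoPhaseBob_of_le hn, timeOf_twoPhaseBob_of_le hn.le]
      exact div_le_div_of_nonneg_right (hmono n.le_succ) (by linarith [hρ.2])
    · rw [timeOf_twoPhaseBob_of_ge hn, timeOf_twoPhaseBob_of_ge (by omega)]
      have := hmono (by omega : n + replaced k j ρ x ≤ n + 1 + replaced k j ρ x)
      linarith
  exact fun a b hab => h (Nat.succ_le_succ hab)

end

lemma measurable_phaseEnd (k : ℕ) (ρ : ℝ) : Measurable (phaseEnd k ρ) :=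
  (measurable_timeOf k).div_const _

lemma measurable_twoPhaseAlice (k j : ℕ) (ρ : ℝ) : Measurable (twoPhaseAlice k j ρ) := by
  classical
  refine measurable_pi_lambda _ fun n => (measurable_pi_apply n).prodMk ?_
  have hs : MeasurableSet {x : ℕ → ℝ | IsReplaced k j ρ x n} :=
    (measurableSet_lt (measurable_phaseEnd k ρ) (measurable_pi_apply n)).inter
      ((measurableSet_le (measurable_timeOf _) (measurable_phaseEnd k ρ)).inter
        (measurableSet_le (measurable_pi_apply _) (measurable_phaseEnd k ρ)))
  refine measurable_to_bool ?_
  convert hs using 1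
  ext x
  simp

lemma measurable_twoPhaseBob (k j : ℕ) (ρ : ℝ) : Measurable (twoPhaseBob k j ρ) := by
  refine measurable_pi_lambda _ fun n => ?_
  unfold twoPhaseBob
  split_ifs with h
  · exact (measurable_pi_apply n).div_const _
  · have hJ : Measurable (replaced k j ρ) :=
      Measurable.ite (measurableSet_le (measurable_timeOf _) (measurable_phaseEnd k ρ))
        measurable_const measurable_const
    have h1 : Measurable fun x : ℕ → ℝ => x (n + replaced k j ρ x) :=
      measurable_from_prod_countable_left (f := fun q : (ℕ → ℝ) × ℕ => q.1 (n + q.2))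
        (fun i => by exact measurable_pi_apply (n + i)) |>.comp (measurable_id.prodMk hJ)
    have h2 : Measurable fun x : ℕ → ℝ => timeOf x (k + replaced k j ρ x) :=
      measurable_from_prod_countable_left (f := fun q : (ℕ → ℝ) × ℕ => timeOf q.1 (k + q.2))
        (fun i => by exact measurable_timeOf (k + i)) |>.comp (measurable_id.prodMk hJ)
    exact h1.add ((measurable_phaseEnd k ρ).sub h2)

/-- The two-phase scheme with a prescribed number of replaced packets. -/
noncomputable def twoPhase (k j : ℕ) (ρ : ℝ) (hρ : ρ ∈ Ioo (0 : ℝ) 1) : Strategy where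
  alice _ x := twoPhaseAlice k j ρ x
  -- Bob may ignore the labels: the times that he sees are Jack's, and they determine which packets
  -- were replaced.
  bob _ y := twoPhaseBob k j ρ fun n => (y n).1
  measurable_alice := (measurable_twoPhaseAlice k j ρ).comp measurable_snd
  measurable_bob := (measurable_twoPhaseBob k j ρ).comp
    (measurable_pi_lambda _ fun n => ((measurable_pi_apply n).comp measurable_snd).fst)
  alice_nonneg _ _ hx n := (hx.pos n).le
  alice_mono _ _ hx := hx.1.monotone
  alice_tendsto _ _ hx := hx.2.2
  bob_mono _ _ _ hx := twoPhaseBob_mono hρ hx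
  alice_causal _ x x' t hx hx' h n hn := by
    have he : x n = x' n := h n hn
    have hn1 : x n ≤ t := by rcases hn with hn | hn; exacts [hn, he.trans_le hn]
    refine Prod.ext he (Bool.eq_iff_iff.2 ?_)
    rw [twoPhaseAlice_snd, twoPhaseAlice_snd]
    exact ⟨h.isReplaced hρ hx hn1, h.symm.isReplaced hρ hx' (he.symm.trans_le hn1)⟩
  bob_causal _ _ _ x x' t hx hx' h n hn := by
    have h' : AgreeUpTo t x x' := fun i hi => congrArg Prod.fst (h i hi)
    rcases hn with hn | hn
    · exact h'.twoPhaseBob_eq hρ hx hn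
    · exact (h'.symm.twoPhaseBob_eq hρ hx' hn).symm
  alice_feasible _ _ hx _ _ := hx.1.monotone (Nat.count_le _)
  bob_feasible _ _ x hx n := by
    obtain ⟨m, hkm, -, hm⟩ := exists_isReplaced_iff (k := k) (j := j) hρ hx
    have hy : ∀ i, (twoPhaseAlice k j ρ x i).2 = true ↔ m ≤ i ∧ i < m + replaced k j ρ x :=
      fun i => twoPhaseAlice_snd.trans (hm i)
    have hcount := jackAmong_of_consecutive hy
    -- Before the replaced block, Jack's packet `n` travels in place `n`; from the block on, in
    -- place `n + J`. Bob's sending time is late enough for both.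
    rcases lt_or_ge n m with hn | hn
    · refine ⟨n, ?_, ?_, ?_⟩
      · rw [← Bool.not_eq_true, hy]; omega
      · rw [hcount, if_pos hn.le]
      · rcases lt_or_ge n k with hk | hk
        · exact (le_div_one_sub hρ (hx.pos n).le).trans_eq (if_pos hk).symm
        · exact (hx.1.monotone (Nat.le_add_right _ _)).trans (le_twoPhaseBob hρ hx hk)
    · refine ⟨n + replaced k j ρ x, ?_, ?_, le_twoPhaseBob hρ hx (by omega)⟩
      · rw [← Bool.not_eq_true, hy]; omega
      · rw [hcount]
        split_ifs <;> omega

lemma encard_isReplaced {k j : ℕ} {ρ : ℝ} {x : ℕ → ℝ} (hρ : ρ ∈ Ioo (0 : ℝ) 1)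
    (hx : IsStream x) : {n | IsReplaced k j ρ x n}.encard = replaced k j ρ x := by
  obtain ⟨m, -, -, hm⟩ := exists_isReplaced_iff (k := k) (j := j) hρ hx
  have : {n | IsReplaced k j ρ x n} = (Finset.Ico m (m + replaced k j ρ x) : Set ℕ) := by
    ext i
    simp [hm]
  rw [this, Set.encard_coe_eq_coe_finsetCard, Nat.card_Ico, Nat.add_sub_cancel_left]

lemma twoPhase_isTwoPhase (k j : ℕ) (ρ : ℝ) (hρ : ρ ∈ Ioo (0 : ℝ) 1) :
    (twoPhase k j ρ hρ).IsTwoPhase k ρ where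
  alice_timing _ _ _ _ := rfl
  alice_idle _ _ _ _ hn := (twoPhaseAlice_snd.1 hn).1
  bob_first _ _ _ _ _ hn := if_pos hn
  second _ _ x hx := by
    refine ⟨replaced k j ρ x, phaseEnd k ρ x - timeOf x (k + replaced k j ρ x),
      sub_nonneg.2 (timeOf_replaced_le hρ hx), ?_, fun i => ?_⟩
    · rw [← encard_isReplaced hρ hx]
      congr 1
      ext n
      exact twoPhaseAlice_snd
    · rw [show k + replaced k j ρ x + i = k + i + replaced k j ρ x by ring]
      exact if_neg (by omega)

/-- If the replaced packets are all sent before Jack's `N`-th packet, then they all count. -/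
lemma twoPhase_inserted {k j N : ℕ} {ρ : ℝ} (hρ : ρ ∈ Ioo (0 : ℝ) 1) {ω : Sample}
    (hω : IsStream (arrivals ω.1)) (hjN : j ≤ N)
    (hE : timeOf (arrivals ω.1) (k + j) ≤ phaseEnd k ρ (arrivals ω.1))
    (hN : phaseEnd k ρ (arrivals ω.1) < arrivals ω.1 (N - j)) :
    (twoPhase k j ρ hρ).inserted N ω = j := by
  obtain ⟨m, -, hm, hr⟩ := exists_isReplaced_iff (k := k) (j := j) hρ hω
  have hJ : replaced k j ρ (arrivals ω.1) = j := if_pos hE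
  have hmN := (hm (N - j)).2 hN
  have hset : {n | ((twoPhase k j ρ hρ).aliceOut ω n).2 = true ∧
      ((twoPhase k j ρ hρ).aliceOut ω n).1 ≤ timeOf (arrivals ω.1) N} =
      {n | IsReplaced k j ρ (arrivals ω.1) n} := by
    ext n
    refine ⟨fun h => twoPhaseAlice_snd.1 h.1, fun h => ⟨twoPhaseAlice_snd.2 h, ?_⟩⟩
    have hn := (hr n).1 h
    rw [hJ] at hn
    exact hω.timeOf_strictMono.monotone (by omega : n + 1 ≤ N)
  change Set.ncard _ = _
  rw [hset, Set.ncard_def, encard_isReplaced hρ hω, hJ]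
  rfl

/-! ### Law of the stretched stream -/

namespace IPDDensity

variable (p : IPDDensity)

/-- Selecting and transforming Jack's delays one by one gives independent delays. -/
lemma map_streamLaw {e : ℕ → ℕ} (he : Function.Injective e) {h : ℕ → ℝ → ℝ}
    (hh : ∀ i, Measurable (h i)) :
    p.streamLaw.map (fun z i => h i (z (e i))) =
      Measure.infinitePi fun i => p.law.map (h i) := by
  have hind : iIndepFun (fun i (z : ℕ → ℝ) => h i (z (e i))) p.streamLaw :=
    (p.iIndepFun_eval.precomp he).comp h hh
  have hm : ∀ i, Measurable fun z : ℕ → ℝ => h i (z (e i)) := fun i =>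
    (hh i).comp (measurable_pi_apply (e i))
  rw [hind.map_fun_eq_infinitePi_map hm]
  congr 1
  funext i
  rw [← (p.measurePreserving_eval (e i)).map_eq, Measure.map_map (hh i) (measurable_pi_apply _)]
  rfl

lemma measurePreserving_shift (k : ℕ) :
    MeasurePreserving (fun (z : ℕ → ℝ) i => z (i + k)) p.streamLaw p.streamLaw := by
  refine ⟨measurable_pi_lambda _ fun i => measurable_pi_apply (i + k), ?_⟩
  have h := p.map_streamLaw (add_left_injective k) (h := fun _ => id) fun _ => measurable_id
  simp only [Measure.map_id, id] at h
  exact h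

/-- The first `k` delays are stretched, and `j` delays are dropped after them. -/
noncomputable def stretchDrop (k j : ℕ) (ρ : ℝ) (z : ℕ → ℝ) (n : ℕ) : ℝ :=
  if n < k then z n / (1 - ρ) else z (n + j)

lemma measurable_stretchDrop (k j : ℕ) (ρ : ℝ) : Measurable (stretchDrop k j ρ) := by
  refine measurable_pi_lambda _ fun n => ?_
  unfold stretchDrop
  split_ifs
  exacts [(measurable_pi_apply n).div_const _, measurable_pi_apply (n + j)]

variable {p}

/-- The retained indices are distinct, so the output is an independent sequence with `k` stretched
factors; the affinity bound for products applies. -/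
lemma Regular.stretchDrop_le (hp : p.Regular) {k j : ℕ} {ρ : ℝ} (hρ : ρ < 1)
    {D : Set (ℕ → ℝ)} (hD : MeasurableSet D) {t : ℝ} (ht : 0 < t) :
    p.streamLaw.real (stretchDrop k j ρ ⁻¹' D) ≤ p.streamLaw.real D +
      ((1 - (∫ x, p.sqrtRatio ρ x ∂p.law) ^ k) / t + 2 * t) := by
  have hdiv : Measurable fun x : ℝ => x / (1 - ρ) := measurable_id.div_const _
  let h : ℕ → ℝ → ℝ := fun i => if i < k then fun x => x / (1 - ρ) else id
  have hh : ∀ i, Measurable (h i) := fun i => by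
    simp only [h]; split_ifs
    exacts [hdiv, measurable_id]
  have he : Function.Injective fun i : ℕ => if i < k then i else i + j := fun a b hab => by
    simp only at hab
    split_ifs at hab <;> omega
  have hmap := p.map_streamLaw he hh
  have hfun : (fun (z : ℕ → ℝ) i => h i (z (if i < k then i else i + j))) =
      stretchDrop k j ρ := by
    funext z i
    simp only [h, stretchDrop]
    split_ifs <;> rfl
  rw [hfun] at hmap
  have : ∀ i, IsProbabilityMeasure (p.law.map (h i)) := fun i =>
    Measure.isProbabilityMeasure_map (hh i).aemeasurable
  have : IsProbabilityMeasure (p.law.map fun x => x / (1 - ρ)) :=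
    Measure.isProbabilityMeasure_map hdiv.aemeasurable
  have hle := infinitePi_le_of_affinity (P := p.law) (hp.measurable_sqrtRatio hρ)
    (map_div_law hρ) k (μ := fun i => p.law.map (h i))
    (fun i => by
      simp only [h]; split_ifs
      exacts [rfl, Measure.map_id]) hD ht
  rwa [← hmap, map_measureReal_apply (measurable_stretchDrop k j ρ) hD] at hle

end IPDDensity

/-! ### Law of large numbers for the buffer and the phase lengths -/

lemma tendsto_measureReal_of_ae_eventually {Ω : Type*} [MeasurableSpace Ω] {P : Measure Ω}
    [IsProbabilityMeasure P] {A : ℕ → Set Ω} (hA : ∀ n, MeasurableSet (A n))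
    (h : ∀ᵐ ω ∂P, ∀ᶠ n in atTop, ω ∈ A n) : Tendsto (fun n => P.real (A n)) atTop (𝓝 1) := by
  have h1 := tendsto_measure_of_ae_tendsto_indicator_of_isFiniteMeasure (μ := P) (A := univ)
    atTop MeasurableSet.univ hA (h.mono fun ω hω => hω.mono fun n hn => by simpa using hn)
  rw [measure_univ] at h1
  exact (ENNReal.tendsto_toReal ENNReal.one_ne_top).comp h1

lemma tendsto_natFloor_div {u v : ℕ → ℝ} {a : ℝ} (hv : Tendsto v atTop atTop)
    (hu : ∀ N, 0 ≤ u N) (h : Tendsto (fun N => u N / v N) atTop (𝓝 a)) :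
    Tendsto (fun N => (⌊u N⌋₊ : ℝ) / v N) atTop (𝓝 a) := by
  have h1 : Tendsto (fun N => u N / v N - (v N)⁻¹) atTop (𝓝 a) := by
    simpa using h.sub hv.inv_tendsto_atTop
  refine tendsto_of_tendsto_of_tendsto_of_le_of_le' h1 h ?_ ?_
  · filter_upwards [hv.eventually_gt_atTop 0] with N hN
    rw [← one_div, ← sub_div]
    gcongr
    linarith [Nat.lt_floor_add_one (u N)]
  · filter_upwards [hv.eventually_gt_atTop 0] with N hN
    gcongr
    exact Nat.floor_le (hu N)

section

variable {p : IPDDensity} {ψ a c : ℝ} {ρ : ℕ → ℝ}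

lemma tendsto_sqrt_natCast : Tendsto (fun N : ℕ => √(N : ℝ)) atTop atTop :=
  Real.tendsto_sqrt_atTop.comp tendsto_natCast_atTop_atTop

lemma tendsto_natFloor_mul_atTop {u : ℕ → ℝ} (hc : 0 < c) (hu : Tendsto u atTop atTop) :
    Tendsto (fun N => ⌊c * u N⌋₊) atTop atTop :=
  tendsto_nat_floor_atTop.comp (hu.const_mul_atTop hc)

/-- With high probability Bob's buffer is full enough after the first phase. -/
lemma tendsto_bufferFull (hψ : 0 < ψ) (ha : 0 < a)
    (hρ : ∀ N, ρ N ∈ Ioo (0 : ℝ) 1) (hρa : ∀ N : ℕ, a / √(N + 1) ≤ ρ N) :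
    Tendsto (fun N : ℕ => p.streamLaw.real
      {z | timeOf (arrivals z) (⌊ψ * N⌋₊ + ⌊ψ * a / 16 * √(N : ℝ)⌋₊) ≤
        phaseEnd ⌊ψ * N⌋₊ (ρ N) (arrivals z)}) atTop (𝓝 1) := by
  have hμ := p.mean_pos
  set k : ℕ → ℕ := fun N => ⌊ψ * N⌋₊ with hk
  set j : ℕ → ℕ := fun N => ⌊ψ * a / 16 * √(N : ℝ)⌋₊ with hj
  have hkt : Tendsto k atTop atTop := tendsto_natFloor_mul_atTop hψ tendsto_natCast_atTop_atTop
  have hjt : Tendsto j atTop atTop :=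
    tendsto_natFloor_mul_atTop (by positivity) tendsto_sqrt_natCast
  let A : ℕ → Set (ℕ → ℝ) := fun N => {z | timeOf (arrivals z) (j N) ≤ 2 * p.mean * j N}
  let B : ℕ → Set (ℕ → ℝ) := fun N => {z | p.mean / 2 * k N ≤ timeOf (arrivals z) (k N)}
  have hmt : ∀ n, Measurable fun z : ℕ → ℝ => timeOf (arrivals z) n := fun n =>
    (measurable_timeOf n).comp measurable_arrivals
  have hAm : ∀ N, MeasurableSet (A N) := fun N => measurableSet_le (hmt _) measurable_const
  have hBm : ∀ N, MeasurableSet (B N) := fun N => measurableSet_le measurable_const (hmt _)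
  have hA : Tendsto (fun N => p.streamLaw.real (A N)) atTop (𝓝 1) := by
    refine tendsto_measureReal_of_ae_eventually hAm ?_
    filter_upwards [p.ae_tendsto_mean] with z hz
    filter_upwards [(hz.comp hjt).eventually_le_const (by linarith : p.mean < 2 * p.mean),
      hjt.eventually_gt_atTop 0] with N hN hN0
    have : (0 : ℝ) < j N := by exact_mod_cast hN0
    change timeOf (arrivals z) (j N) ≤ _
    rw [timeOf_arrivals]
    exact (div_le_iff₀ this).1 hN
  have hB : Tendsto (fun N => p.streamLaw.real (B N)) atTop (𝓝 1) := by
    refine tendsto_measureReal_of_ae_eventually hBm ?_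
    filter_upwards [p.ae_tendsto_mean] with z hz
    filter_upwards [(hz.comp hkt).eventually_const_le (by linarith : p.mean / 2 < p.mean),
      hkt.eventually_gt_atTop 0] with N hN hN0
    have : (0 : ℝ) < k N := by exact_mod_cast hN0
    change _ ≤ timeOf (arrivals z) (k N)
    rw [timeOf_arrivals]
    exact (le_div_iff₀ this).1 hN
  -- The `j` delays after the first phase form a moving block. Shift invariance gives it the
  -- probability of an initial block, to which the law of large numbers applies.
  have hA' : ∀ N, p.streamLaw.real ((fun (z : ℕ → ℝ) i => z (i + k N)) ⁻¹' A N) =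
      p.streamLaw.real (A N) := fun N =>
    (p.measurePreserving_shift (k N)).measureReal_preimage (hAm N).nullMeasurableSet
  have hlow : Tendsto (fun N => 1 - ((1 - p.streamLaw.real (A N)) +
      (1 - p.streamLaw.real (B N)))) atTop (𝓝 1) := by
    simpa using ((hA.const_sub 1).add (hB.const_sub 1)).const_sub 1
  refine tendsto_of_tendsto_of_tendsto_of_le_of_le' hlow tendsto_const_nhds ?_
    (Eventually.of_forall fun N => measureReal_le_one)
  filter_upwards [tendsto_natCast_atTop_atTop.eventually_ge_atTop (2 / ψ),
    eventually_ge_atTop 1] with N hN hN1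
  have hN1' : (1 : ℝ) ≤ N := by exact_mod_cast hN1
  -- The buffer is full if the next `j` delays, at most `2 μ j`, fit into the time gained, at least
  -- `ρ μ k / 2`; this asks for `4 j ≤ k ρ`. The lower bounds `ψ N / 2` for `k` and `a / (2 √N)` for
  -- `ρ` explain the `16` in `j`.
  have hnum : 4 * (j N : ℝ) ≤ k N * ρ N := by
    have hsq : √(N : ℝ) * √(N : ℝ) = N := Real.mul_self_sqrt N.cast_nonneg
    have hs1 : 0 < √(N : ℝ) := Real.sqrt_pos.2 (by linarith)
    have h1 : (j N : ℝ) ≤ ψ * a / 16 * √(N : ℝ) := Nat.floor_le (by positivity)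
    have h2 : ψ * N / 2 ≤ k N := by
      have h3 := Nat.lt_floor_add_one (ψ * (N : ℝ))
      rw [div_le_iff₀ hψ] at hN
      change ψ * N / 2 ≤ (⌊ψ * (N : ℝ)⌋₊ : ℝ)
      linarith
    have h4 : √((N : ℝ) + 1) ≤ 2 * √(N : ℝ) := by
      rw [Real.sqrt_le_left (by positivity), mul_pow, Real.sq_sqrt N.cast_nonneg]
      linarith
    have h5 : a / (2 * √(N : ℝ)) ≤ ρ N := le_trans (by gcongr) (hρa N)
    calc 4 * (j N : ℝ) ≤ 4 * (ψ * a / 16 * √(N : ℝ)) := by linarith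
      _ = ψ * N / 2 * (a / (2 * √(N : ℝ))) := by
        nth_rewrite 2 [← hsq]
        field_simp
        norm_num
      _ ≤ k N * ρ N := by gcongr
  have hsub : (fun (z : ℕ → ℝ) i => z (i + k N)) ⁻¹' A N ∩ B N ⊆
      {z | timeOf (arrivals z) (k N + j N) ≤ phaseEnd (k N) (ρ N) (arrivals z)} := by
    rintro z ⟨hzA, hzB⟩
    have hzA' : timeOf (arrivals fun i => z (i + k N)) (j N) ≤ 2 * p.mean * j N := hzA
    have hzB' : p.mean / 2 * k N ≤ timeOf (arrivals z) (k N) := hzB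
    rw [timeOf_arrivals] at hzA' hzB'
    change timeOf (arrivals z) (k N + j N) ≤ timeOf (arrivals z) (k N) / (1 - ρ N)
    have h1 : 0 < 1 - ρ N := by linarith [(hρ N).2]
    rw [timeOf_arrivals, timeOf_arrivals, Finset.sum_range_add, le_div_iff₀ h1]
    simp only [add_comm _ (k N)] at hzA'
    set s := ∑ i ∈ Finset.range (k N), z i
    set r := ∑ i ∈ Finset.range (j N), z (k N + i)
    have hρ0 := (hρ N).1
    have h2 : p.mean / 2 * (4 * (j N : ℝ)) ≤ s * ρ N := by
      calc p.mean / 2 * (4 * (j N : ℝ)) ≤ p.mean / 2 * (k N * ρ N) := by gcongr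
        _ = p.mean / 2 * k N * ρ N := by ring
        _ ≤ s * ρ N := by gcongr
    have h3 : r * (1 - ρ N) ≤ 2 * p.mean * j N := by
      calc r * (1 - ρ N) ≤ 2 * p.mean * j N * (1 - ρ N) := by gcongr
        _ ≤ 2 * p.mean * j N * 1 := by gcongr; linarith
        _ = _ := mul_one _
    linarith
  have hm := measureReal_le_of_ae (P := p.streamLaw) (A := univ)
    (D := (fun (z : ℕ → ℝ) i => z (i + k N)) ⁻¹' A N ∩ B N)
    ((p.measurePreserving_shift (k N)).measurable (hAm N)) (hBm N)
    (ae_of_all _ fun z _ h1 h2 => ⟨h1, h2⟩)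
  rw [hA', probReal_univ] at hm
  have := measureReal_mono (μ := p.streamLaw) hsub
  linarith

/-- With high probability the second phase begins long before Jack's `N`-th packet. -/
lemma tendsto_phaseEnd_lt (hψ : ψ ∈ Ioo (0 : ℝ) 1) (hc : 0 ≤ c)
    (hρ0 : Tendsto ρ atTop (𝓝 0)) :
    Tendsto (fun N : ℕ => p.streamLaw.real
      {z | phaseEnd ⌊ψ * N⌋₊ (ρ N) (arrivals z) < arrivals z (N - ⌊c * √(N : ℝ)⌋₊)})
      atTop (𝓝 1) := by
  have hμ := p.mean_pos
  have hcast : Tendsto (fun N : ℕ => (N : ℝ)) atTop atTop := tendsto_natCast_atTop_atTop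
  set k : ℕ → ℕ := fun N => ⌊ψ * N⌋₊ with hk
  set j : ℕ → ℕ := fun N => ⌊c * √(N : ℝ)⌋₊ with hj
  have hkt : Tendsto k atTop atTop := tendsto_natFloor_mul_atTop hψ.1 hcast
  have hkN : Tendsto (fun N => (k N : ℝ) / N) atTop (𝓝 ψ) := by
    refine tendsto_natFloor_div hcast (fun N => by have := hψ.1; positivity) ?_
    refine tendsto_const_nhds.congr' ?_
    filter_upwards [eventually_gt_atTop 0] with N hN
    have : (N : ℝ) ≠ 0 := by positivity
    field_simp
  have hjN : Tendsto (fun N => (j N : ℝ) / N) atTop (𝓝 0) := by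
    refine tendsto_natFloor_div hcast (fun N => by positivity) ?_
    have h := tendsto_sqrt_natCast.inv_tendsto_atTop.const_mul c
    rw [mul_zero] at h
    refine h.congr' ?_
    filter_upwards [eventually_gt_atTop 0] with N hN
    have h1 : √(N : ℝ) ≠ 0 := by positivity
    have h2 : (N : ℝ) = √(N : ℝ) ^ 2 := (Real.sq_sqrt N.cast_nonneg).symm
    simp only [Pi.inv_apply]
    nth_rewrite 3 [h2]
    field_simp
  have hjle : ∀ᶠ N in atTop, j N ≤ N := by
    filter_upwards [hjN.eventually_le_const zero_lt_one, eventually_gt_atTop 0] with N h h0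
    have h0' : (0 : ℝ) < N := by exact_mod_cast h0
    rw [div_le_iff₀ h0', one_mul] at h
    exact_mod_cast h
  have hmN : Tendsto (fun N => ((N - j N + 1 : ℕ) : ℝ) / N) atTop (𝓝 1) := by
    have h : Tendsto (fun N : ℕ => 1 - (j N : ℝ) / N + (N : ℝ)⁻¹) atTop (𝓝 (1 - 0 + 0)) :=
      (hjN.const_sub 1).add hcast.inv_tendsto_atTop
    rw [sub_zero, add_zero] at h
    refine h.congr' ?_
    filter_upwards [hjle, eventually_gt_atTop 0] with N h1 h0
    have : (N : ℝ) ≠ 0 := by positivity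
    rw [Nat.cast_add, Nat.cast_sub h1, Nat.cast_one]
    field_simp
  have hmt : Tendsto (fun N => N - j N + 1) atTop atTop := by
    have h := hmN.pos_mul_atTop zero_lt_one hcast
    refine tendsto_natCast_atTop_iff.1 (h.congr' ?_)
    filter_upwards [eventually_gt_atTop 0] with N h0
    have : (N : ℝ) ≠ 0 := by positivity
    exact div_mul_cancel₀ _ this
  refine tendsto_measureReal_of_ae_eventually (fun N => measurableSet_lt
    ((measurable_phaseEnd _ _).comp measurable_arrivals)
    ((measurable_pi_apply _).comp measurable_arrivals)) ?_
  -- Divided by `N`, the end of the first phase tends to `μ ψ` and the time of packet index `N - j`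
  -- to `μ`, because `j / N → 0`; and `ψ < 1`.
  filter_upwards [p.ae_tendsto_mean] with z hz
  have h1 : Tendsto (fun N => (∑ i ∈ Finset.range (k N), z i) / k N * (k N / N) / (1 - ρ N)) atTop
      (𝓝 (p.mean * ψ / (1 - 0))) :=
    ((hz.comp hkt).mul hkN).div (hρ0.const_sub 1) (by norm_num)
  have h2 : Tendsto (fun N => (∑ i ∈ Finset.range (N - j N + 1), z i) / (N - j N + 1 : ℕ) *
      ((N - j N + 1 : ℕ) / N)) atTop (𝓝 (p.mean * 1)) := (hz.comp hmt).mul hmN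
  have hlt : p.mean * ψ / (1 - 0) < p.mean * 1 := by
    rw [sub_zero, div_one]
    exact mul_lt_mul_of_pos_left hψ.2 hμ
  filter_upwards [h1.eventually_lt h2 hlt, hkt.eventually_gt_atTop 0, eventually_gt_atTop 0]
    with N hN hk0 hN0
  have e1 : (k N : ℝ) ≠ 0 := by positivity
  have e2 : (0 : ℝ) < N := by exact_mod_cast hN0
  have e3 : ((N - j N + 1 : ℕ) : ℝ) ≠ 0 := by positivity
  rw [div_mul_div_cancel₀ e1, div_mul_div_cancel₀ e3, div_right_comm,
    div_lt_div_iff_of_pos_right e2] at hN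
  change timeOf (arrivals z) (k N) / (1 - ρ N) < _
  rw [timeOf_arrivals]
  exact hN

end

/-! ### Covertness and the choice of constants -/

lemma measurableSet_bufferFull (k j : ℕ) (ρ : ℝ) : MeasurableSet
    {z : ℕ → ℝ | timeOf (arrivals z) (k + j) ≤ phaseEnd k ρ (arrivals z)} :=
  measurableSet_le ((measurable_timeOf _).comp measurable_arrivals)
    ((measurable_phaseEnd k ρ).comp measurable_arrivals)

lemma measureReal_preimage_fst (p : IPDDensity) {A : Set (ℕ → ℝ)} (hA : MeasurableSet A) :
    (sampleLaw p).real (Prod.fst ⁻¹' A) = p.streamLaw.real A :=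
  (measurePreserving_fst p).measureReal_preimage hA.nullMeasurableSet

/-- Location 1 shows Jack's own stream, so there the error sum is exactly `1`. At location 2 the
observation is coupled with `stretchDrop`; they agree whenever the buffer is full. -/
lemma IPDDensity.Regular.isCovert_twoPhase {p : IPDDensity} (hp : p.Regular) {k j : ℕ} {ρ t ε : ℝ}
    (hρ : ρ ∈ Ioo (0 : ℝ) 1) (ht : 0 < t) (hε0 : 0 ≤ ε)
    (hε : (1 - (∫ x, p.sqrtRatio ρ x ∂p.law) ^ k) / t + 2 * t +
      (1 - p.streamLaw.real {z | timeOf (arrivals z) (k + j) ≤ phaseEnd k ρ (arrivals z)}) ≤ ε) :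
    IsCovert p (twoPhase k j ρ hρ) ε := by
  intro D hD
  constructor
  · have h : {ω | (twoPhase k j ρ hρ).obs₁ ω ∉ D} = Prod.fst ⁻¹' Dᶜ := by
      ext ω
      change delays (arrivals ω.1) ∉ D ↔ ω.1 ∉ D
      rw [delays_arrivals]
    rw [errorSum, h, measureReal_preimage_fst p hD.compl, probReal_compl_eq_one_sub hD]
    linarith
  · set E := {z : ℕ → ℝ | timeOf (arrivals z) (k + j) ≤ phaseEnd k ρ (arrivals z)} with hEdef
    have hE : MeasurableSet E := measurableSet_bufferFull k j ρ
    have hobs := (twoPhase k j ρ hρ).measurable_obs₂ hD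
    have h1 := measureReal_le_of_ae (P := sampleLaw p)
      (A := (twoPhase k j ρ hρ).obs₂ ⁻¹' D)
      (D := Prod.fst ⁻¹' (IPDDensity.stretchDrop k j ρ ⁻¹' D))
      (measurable_fst hE) MeasurableSet.univ (ae_of_all _ fun ω hA hB _ => by
        have hJ : replaced k j ρ (arrivals ω.1) = j := if_pos hB
        have hω : (twoPhase k j ρ hρ).obs₂ ω = IPDDensity.stretchDrop k j ρ ω.1 := by
          funext n
          exact (delays_twoPhaseBob ω.1 n).trans (by rw [hJ]; rfl)
        change IPDDensity.stretchDrop k j ρ ω.1 ∈ D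
        rw [← hω]
        exact hA)
    rw [measureReal_preimage_fst p (IPDDensity.measurable_stretchDrop k j ρ hD),
      measureReal_preimage_fst p hE, probReal_univ] at h1
    have h2 := hp.stretchDrop_le (k := k) (j := j) hρ.2 hD ht
    have h3 : (sampleLaw p).real {ω | (twoPhase k j ρ hρ).obs₂ ω ∉ D} = 1 - (sampleLaw p).real
        ((twoPhase k j ρ hρ).obs₂ ⁻¹' D) := probReal_compl_eq_one_sub hobs
    rw [errorSum, h3]
    linarith

lemma exists_sq_mul_le {C m η : ℝ} (hC : 0 ≤ C) (hm : 0 < m) (hη : 0 < η) :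
    ∃ a, 0 < a ∧ a < η ∧ C * a ^ 2 ≤ m := by
  refine ⟨min (η / 2) √(m / (C + 1)), by positivity, (min_le_left _ _).trans_lt (by linarith), ?_⟩
  have h : min (η / 2) √(m / (C + 1)) ^ 2 ≤ √(m / (C + 1)) ^ 2 :=
    pow_le_pow_left₀ (by positivity) (min_le_right _ _) 2
  rw [Real.sq_sqrt (by positivity), le_div_iff₀ (by positivity)] at h
  nlinarith [sq_nonneg (min (η / 2) √(m / (C + 1)))]

theorem achievability (p : IPDDensity) (hp : p.Regular) (ε : ℝ) (hε : 0 < ε) (ψ : ℝ)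
    (hψ : ψ ∈ Ioo (0 : ℝ) 1) :
    ∃ (S : ℕ → Strategy) (ρ : ℕ → ℝ) (d d' : ℝ), 0 < d ∧
      (∀ N, ρ N ∈ Ioo (0 : ℝ) 1 ∧ (S N).IsTwoPhase ⌊ψ * N⌋₊ (ρ N)) ∧
      (∀ᶠ N in atTop, IsCovert p (S N) ε) ∧
      Tendsto (fun N : ℕ => (sampleLaw p).real
        {ω | d * √(N : ℝ) ≤ (S N).inserted N ω ∧ (S N).inserted N ω ≤ d' * √(N : ℝ)})
        atTop (𝓝 1) := by
  obtain ⟨C, η, hC, hη, hη1, haff⟩ := hp.affinity_ge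
  -- The bound `1` keeps the base `1 - C ρ²` of Bernoulli's inequality nonnegative. The bound `ε² /
  -- 32`, divided by `t = ε / 8`, costs `ε / 4`; the term `2 t` costs another `ε / 4`, and a buffer
  -- that is not full the remaining `ε / 2`.
  obtain ⟨a, ha, haη, haC⟩ := exists_sq_mul_le hC
    (lt_min one_pos (by positivity : 0 < ε ^ 2 / 32)) hη
  have hs1 : ∀ N : ℕ, 1 ≤ √((N : ℝ) + 1) := fun N =>
    Real.one_le_sqrt.2 (by linarith [N.cast_nonneg (α := ℝ)])
  -- With `N + 1` under the root, `ρ N` is admissible for every `N`, including `0`.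
  set ρ : ℕ → ℝ := fun N => a / √((N : ℝ) + 1) with hρdef
  have hρη : ∀ N, ρ N ∈ Ioo 0 η := fun N =>
    ⟨div_pos ha (by linarith [hs1 N]), (div_le_self ha.le (hs1 N)).trans_lt haη⟩
  have hρ : ∀ N, ρ N ∈ Ioo (0 : ℝ) 1 := fun N => ⟨(hρη N).1, (hρη N).2.trans_le hη1⟩
  have hρ0 : Tendsto ρ atTop (𝓝 0) := by
    have h := ((Real.tendsto_sqrt_atTop.comp (tendsto_atTop_add_const_right atTop (1 : ℝ)
      tendsto_natCast_atTop_atTop)).inv_tendsto_atTop).const_mul a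
    rw [mul_zero] at h
    exact h
  set c := ψ * a / 16 with hc
  have hc0 : 0 < c := by have := hψ.1; positivity
  set k : ℕ → ℕ := fun N => ⌊ψ * N⌋₊ with hk
  set j : ℕ → ℕ := fun N => ⌊c * √(N : ℝ)⌋₊ with hj
  have hfull := tendsto_bufferFull (p := p) hψ.1 ha hρ fun N => le_rfl
  have hend := tendsto_phaseEnd_lt (p := p) (c := c) hψ hc0.le hρ0
  refine ⟨fun N => twoPhase (k N) (j N) (ρ N) (hρ N), ρ, c / 2, c, by positivity,
    fun N => ⟨hρ N, twoPhase_isTwoPhase _ _ _ _⟩, ?_, ?_⟩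
  · filter_upwards [hfull.eventually_const_le (by linarith : 1 - ε / 2 < 1)] with N hN
    refine hp.isCovert_twoPhase (t := ε / 8) (hρ N) (by positivity) hε.le ?_
    have h1 : C * ρ N ^ 2 * k N ≤ ε ^ 2 / 32 := by
      have hN0 : (0 : ℝ) ≤ N := N.cast_nonneg
      have h2 : (k N : ℝ) ≤ N + 1 := by
        have h3 : (k N : ℝ) ≤ ψ * N := Nat.floor_le (mul_nonneg hψ.1.le hN0)
        nlinarith [hψ.2]
      calc C * ρ N ^ 2 * k N ≤ C * ρ N ^ 2 * (N + 1) := by gcongr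
        _ = C * a ^ 2 := by
          rw [hρdef]
          simp only [div_pow]
          rw [Real.sq_sqrt (by positivity)]
          field_simp
        _ ≤ _ := haC.trans (min_le_right _ _)
    have h2 : C * ρ N ^ 2 ≤ 1 := by
      have h3 : ρ N ≤ a := div_le_self ha.le (hs1 N)
      have h4 : C * ρ N ^ 2 ≤ C * a ^ 2 := by gcongr
      exact h4.trans (haC.trans (min_le_left _ _))
    have h3 : 1 - C * ρ N ^ 2 * k N ≤ (∫ x, p.sqrtRatio (ρ N) x ∂p.law) ^ k N := by
      have h4 := one_add_mul_le_pow (a := -(C * ρ N ^ 2)) (by linarith) (k N)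
      have h5 : (1 + -(C * ρ N ^ 2)) ^ k N ≤ (∫ x, p.sqrtRatio (ρ N) x ∂p.law) ^ k N :=
        pow_le_pow_left₀ (by linarith) (by linarith [haff (ρ N) (hρη N)]) _
      linarith
    have h4 : (1 - (∫ x, p.sqrtRatio (ρ N) x ∂p.law) ^ k N) / (ε / 8) ≤ ε / 4 := by
      rw [div_le_iff₀ (by positivity)]
      nlinarith
    linarith
  · have hlow : Tendsto (fun N => 1 - ((1 - p.streamLaw.real {z | timeOf (arrivals z)
        (k N + j N) ≤ phaseEnd (k N) (ρ N) (arrivals z)}) + (1 - p.streamLaw.real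
        {z | phaseEnd (k N) (ρ N) (arrivals z) < arrivals z (N - j N)}))) atTop (𝓝 1) := by
      simpa using ((hfull.const_sub 1).add (hend.const_sub 1)).const_sub 1
    refine tendsto_of_tendsto_of_tendsto_of_le_of_le' hlow tendsto_const_nhds ?_
      (Eventually.of_forall fun N => measureReal_le_one)
    filter_upwards [tendsto_sqrt_natCast.eventually_ge_atTop (2 / c),
      tendsto_sqrt_natCast.eventually_ge_atTop c] with N h1 h2
    have hj1 : (j N : ℝ) ≤ c * √(N : ℝ) := Nat.floor_le (by positivity)
    have hj2 : c / 2 * √(N : ℝ) ≤ j N := by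
      have h3 : c * √(N : ℝ) < j N + 1 := Nat.lt_floor_add_one _
      rw [div_le_iff₀ hc0] at h1
      linarith
    have hjN : j N ≤ N := by
      have h3 : √(N : ℝ) * √(N : ℝ) = N := Real.mul_self_sqrt N.cast_nonneg
      have h4 : c * √(N : ℝ) ≤ √(N : ℝ) * √(N : ℝ) := by gcongr
      exact_mod_cast (hj1.trans (h4.trans h3.le))
    have hmB := measurableSet_bufferFull (k N) (j N) (ρ N)
    have hmC : MeasurableSet {z | phaseEnd (k N) (ρ N) (arrivals z) < arrivals z (N - j N)} :=
      measurableSet_lt ((measurable_phaseEnd _ _).comp measurable_arrivals)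
        ((measurable_pi_apply _).comp measurable_arrivals)
    have hle := measureReal_le_of_ae (P := sampleLaw p) (A := univ)
      (D := {ω | c / 2 * √(N : ℝ) ≤ (twoPhase (k N) (j N) (ρ N) (hρ N)).inserted N ω ∧
        (twoPhase (k N) (j N) (ρ N) (hρ N)).inserted N ω ≤ c * √(N : ℝ)})
      (measurable_fst hmB) (measurable_fst hmC)
      ((ae_sample_isStream p).mono fun ω hω _ hB hC => by
        have := twoPhase_inserted (hρ N) hω hjN hB hC
        change _ ≤ _ ∧ _ ≤ _
        rw [this]
        exact ⟨hj2, hj1⟩)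
    rw [measureReal_preimage_fst p hmB, measureReal_preimage_fst p hmC, probReal_univ] at hle
    linarith

end CovertInsertion

open CovertInsertion in
theorem mainTheorem1 (p : IPDDensity) (hp : p.Regular) :
    (∀ ε : ℝ, 0 < ε → ∀ ψ ∈ Ioo (0 : ℝ) 1,
      ∃ (S : ℕ → Strategy) (ρ : ℕ → ℝ) (d d' : ℝ), 0 < d ∧
        (∀ N, ρ N ∈ Ioo (0 : ℝ) 1 ∧ (S N).IsTwoPhase ⌊ψ * N⌋₊ (ρ N)) ∧
        (∀ᶠ N in atTop, IsCovert p (S N) ε) ∧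
        Tendsto (fun N : ℕ => (sampleLaw p).real
          {ω | d * √(N : ℝ) ≤ (S N).inserted N ω ∧ (S N).inserted N ω ≤ d' * √(N : ℝ)})
          atTop (𝓝 1)) ∧
    (IntegrableOn (fun x => x ^ 2 * p.pdf x) (Ioi 0) →
      ∀ f : ℕ → ℕ, Tendsto (fun N : ℕ => (f N : ℝ) / √(N : ℝ)) atTop atTop →
      ∃ (R₁ R₂ : ℕ → ℕ) (U₁ U₂ : ℕ → ℝ),
        Tendsto (fun N => p.streamLaw.real (shortDelayTest p (R₁ N) (U₁ N))) atTop (𝓝 0) ∧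
        Tendsto (fun N => p.streamLaw.real (longDelayTest p (R₂ N) (U₂ N))) atTop (𝓝 0) ∧
        ∀ S : ℕ → Strategy,
          Tendsto (fun N => (sampleLaw p).real {ω | f N ≤ (S N).inserted N ω}) atTop (𝓝 1) →
          (Tendsto (fun N => (sampleLaw p).real {ω | (S N).released N ω = N}) atTop (𝓝 1) →
            Tendsto (fun N => errorSum p (S N).obs₁ (shortDelayTest p (R₁ N) (U₁ N)))
              atTop (𝓝 0)) ∧
          (Tendsto (fun N => (sampleLaw p).real
              {ω | (S N).released N ω + (S N).inserted N ω ≤ N}) atTop (𝓝 1) →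
            Tendsto (fun N => errorSum p (S N).obs₂ (longDelayTest p (R₂ N) (U₂ N)))
              atTop (𝓝 0)) ∧
          Tendsto (fun N => (sampleLaw p).real
              {ω | (S N).obs₁ ω ∉ shortDelayTest p (R₁ N) (U₁ N) ∧
                   (S N).obs₂ ω ∉ longDelayTest p (R₂ N) (U₂ N)}) atTop (𝓝 0)) :=
  ⟨fun ε hε ψ hψ => achievability p hp ε hε ψ hψ, fun h2 f hf => converse p h2 f hf⟩
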